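/- **Setting.** Let $X$ be a Polish space with a $\sigma$-finite Borel measure $\mathfrak m$ of full support, and let $\mathcal E$ be a symmetric Dirichlet form on $L^2(X,\mathfrak m)$ with (dense) domain $\mathbb V$ which is strongly local (that is, $\mathcal E(f,g)=0$ whenever $f,g\in\mathbb V\cap L^\infty$ and $(f+a)g=0$ a.e. for some $a\in\mathbb R$), generates a mass-preserving semigroup $(P_t)_{t\ge0}$ (that is, $\int P_tf\,d\mathfrak m=\int f\,d\mathfrak m$ for $f\in L^1\cap L^2$), and admits a Carré du Champ: a symmetric, nonnegative, bilinear map $\Gamma:\mathbb V\times\mathbb V\to L^1(X,\mathfrak m)$ with $\mathcal E(f,g)=\int\Gamma(f,g)\,d\mathfrak m$ for $f,g\in\mathbb V$ and $\int\Gamma(f,f)\varphi\,d\mathfrak m=\mathcal E(f,f\varphi)-\tfrac12\mathcal E(f^2,\varphi)$ for $f,\varphi\in\mathbb V\cap L^\infty$. Write $\Gamma(f)=\Gamma(f,f)$ and $\|f\|_{\mathbb V}^2=\|f\|_{L^2}^2+\mathcal E(f,f)$. For $f\in\mathbb V$ let $\Delta f\in\mathbb V'$ be defined by $\langle\Delta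 f,g\rangle=-\mathcal E(f,g)$, and put $\Delta_\lambda f=\Delta f-\lambda f$; "$\Delta f\in L^p$" means that this functional is represented by a function in $L^p(X,\mathfrak m)$. Let $\mathbb D=\{f\in\mathbb V:\Delta f\in L^2\}$ with norm $\|f\|_{\mathbb V}+\|f-\Delta f\|_{L^2}$. Let $K\in\mathbb R$. The condition $\mathsf{BE}(K,\infty)$ means that $$\int_X\Big(\tfrac12\Gamma(f)\,\Delta\varphi-\Gamma(f,\Delta f)\,\varphi\Big)\,d\mathfrak m\ \ge\ K\int_X\Gamma(f)\,\varphi\,d\mathfrak m$$ for all $f\in\mathbb V$ with $\Delta f\in\mathbb V$ and all $\varphi\in\mathbb V\cap L^\infty$ with $\varphi\ge0$ and $\Delta\varphi\in L^2\cap L^\infty$. **Theorem (Gradient interpolation).** There is a universal constant $c_2$, and we set $c_\infty=2\pi$, such that for all $X,\mathfrak m,\mathcal E,\Gamma,K$ as above with $\mathsf{BE}(K,\infty)$ the following holds. (1) Let $\lambda\ge K_-:=\max\{-K,0\}$, $p\in\{2,\infty\}$, and let $f\in\mathbb V\cap L^\infty(X,\mathfrak m)$ with $\Delta f\in L^p(X,\mathfrak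 m)$. Then $\Gamma(f)\in L^p(X,\mathfrak m)$ and $$\|\Gamma(f)\|_{L^p}\le c_p\,\|f\|_{L^\infty}\,\|\Delta_\lambda f\|_{L^p}.$$ (For $p=\infty$, equivalently, $\|\sqrt{\Gamma(f)}\|_{L^\infty}\le\sqrt{2\pi}\,\|f\|_{L^\infty}^{1/2}\|\Delta_\lambda f\|_{L^\infty}^{1/2}$.) (2) If $f\in\mathbb D$, $f_n\in\mathbb D\cap L^\infty(X,\mathfrak m)$, $\sup_n\|f_n\|_{L^\infty}<\infty$ and $f_n\to f$ strongly in $\mathbb D$, then $\Gamma(f)$, $\Gamma(f_n)$ and $\Gamma(f_n-f)$ belong to $L^2(X,\mathfrak m)$, and $\Gamma(f_n)\to\Gamma(f)$ and $\Gamma(f_n-f)\to0$ strongly in $L^2(X,\mathfrak m)$. -/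

import Mathlib

open MeasureTheory Filter Topology
open scoped ENNReal NNReal

/-- A (symmetric) Dirichlet form on `L²(X, m)`: a densely defined, nonnegative, symmetric, closed
bilinear form on which normal contractions operate. -/
structure DirichletForm {X : Type*} [MeasurableSpace X] (m : Measure X) where
  /-- The domain `D(𝓔)`, denoted `𝕍`. -/
  domain : Submodule ℝ (Lp ℝ 2 m)
  /-- The bilinear form `𝓔(f, g)`. -/
  form : domain →ₗ[ℝ] domain →ₗ[ℝ] ℝ
  dense_domain : Dense (domain : Set (Lp ℝ 2 m))
  symm : ∀ f g : domain, form f g = form g f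
  nonneg : ∀ f : domain, 0 ≤ form f f
  /-- Closedness: an `L²`-convergent sequence that is Cauchy for the energy converges in energy,
  to a limit in the domain. -/
  closed : ∀ (u : ℕ → domain) (v : Lp ℝ 2 m),
    Tendsto (fun n => (u n : Lp ℝ 2 m)) atTop (𝓝 v) →
    (∀ ε : ℝ, 0 < ε → ∃ N : ℕ, ∀ i ≥ N, ∀ j ≥ N, form (u i - u j) (u i - u j) < ε) →
    ∃ hv : v ∈ domain,
      Tendsto (fun n => form (u n - ⟨v, hv⟩) (u n - ⟨v, hv⟩)) atTop (𝓝 0)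
  /-- Markov property: `𝓔(η ∘ f) ≤ 𝓔(f)` for every `1`-Lipschitz `η` with `η 0 = 0`. -/
  markov : ∀ (η : ℝ → ℝ) (hη : LipschitzWith 1 η) (h0 : η 0 = 0) (f : domain),
    ∃ hf : hη.compLp h0 (f : Lp ℝ 2 m) ∈ domain, form ⟨_, hf⟩ ⟨_, hf⟩ ≤ form f f

namespace DirichletForm

variable {X : Type*} [MeasurableSpace X] {m : Measure X}

/-- Strong locality: `𝓔(f, g) = 0` whenever `f, g ∈ 𝕍 ∩ L^∞` and `(f + a) g = 0` a.e. for
some constant `a`. -/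
def StronglyLocal (E : DirichletForm m) : Prop :=
  ∀ (f g : E.domain) (a : ℝ),
    MemLp (f : Lp ℝ 2 m) ∞ m → MemLp (g : Lp ℝ 2 m) ∞ m →
    (∀ᵐ x ∂m, ((f : Lp ℝ 2 m) x + a) * (g : Lp ℝ 2 m) x = 0) → E.form f g = 0

/-- `Γ : 𝕍 × 𝕍 → L¹(X, m)` is the Carré du Champ of `E`: a symmetric, nonnegative bilinear map
with `𝓔(f, g) = ∫ Γ(f, g)` and
`∫ Γ(f, f) φ = 𝓔(f, f φ) - ½ 𝓔(f², φ)` for `f, φ ∈ 𝕍 ∩ L^∞`.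
(`𝕍 ∩ L^∞` is an algebra; `ff` and `fφ` below are the products `f²` and `f φ`.) -/
structure IsCarreDuChamp (E : DirichletForm m)
    (Γ : E.domain →ₗ[ℝ] E.domain →ₗ[ℝ] Lp ℝ 1 m) : Prop where
  symm : ∀ f g : E.domain, Γ f g = Γ g f
  nonneg : ∀ f : E.domain, ∀ᵐ x ∂m, 0 ≤ (Γ f f) x
  energy : ∀ f g : E.domain, E.form f g = ∫ x, (Γ f g) x ∂m
  representation : ∀ f φ ff fφ : E.domain,
    MemLp (f : Lp ℝ 2 m) ∞ m → MemLp (φ : Lp ℝ 2 m) ∞ m →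
    (∀ᵐ x ∂m, (ff : Lp ℝ 2 m) x = (f : Lp ℝ 2 m) x * (f : Lp ℝ 2 m) x) →
    (∀ᵐ x ∂m, (fφ : Lp ℝ 2 m) x = (f : Lp ℝ 2 m) x * (φ : Lp ℝ 2 m) x) →
    ∫ x, (Γ f f) x * (φ : Lp ℝ 2 m) x ∂m = E.form f fφ - (1 / 2) * E.form ff φ

/-- `Δ f = h` for `f ∈ 𝕍` and a function `h`, always used together with `h ∈ L²` or `h ∈ L^∞`:
`-𝓔(f, g) = ∫ h g` for all `g ∈ 𝕍` such that `h g` is integrable.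
If `h ∈ L²`, then `h g` is integrable for every `g ∈ 𝕍`, so this says that `f` is in the domain of
the `L²` generator of `E` and `h` is its image. If `h ∈ L^∞`, the `g` considered contain
`𝕍 ∩ L¹`, which is dense in `𝕍`, and the functional `Δ f ∈ 𝕍'` is represented by `h`. -/
def HasLaplacian (E : DirichletForm m) (f : E.domain) (h : X → ℝ) : Prop :=
  ∀ g : E.domain, Integrable (fun x => h x * (g : Lp ℝ 2 m) x) m →
    -E.form f g = ∫ x, h x * (g : Lp ℝ 2 m) x ∂m

/-- `u t = P_t f` for `t ≥ 0`, where `P` is the semigroup on `L²(X, m)` generated by `Δ`: `u` is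
continuous on `[0, ∞)`, starts at `f`, and for `t > 0` solves `u' = Δ u` in `L²(X, m)`. -/
def IsHeatFlow (E : DirichletForm m) (f : Lp ℝ 2 m) (u : ℝ → Lp ℝ 2 m) : Prop :=
  u 0 = f ∧ ContinuousOn u (Set.Ici 0) ∧
    ∀ t : ℝ, 0 < t → ∃ (ht : u t ∈ E.domain) (h : Lp ℝ 2 m),
      E.HasLaplacian ⟨u t, ht⟩ h ∧ HasDerivAt u h t

/-- The heat semigroup preserves mass: `∫ P_t f = ∫ f` for `f ∈ L¹ ∩ L²`. -/
def MassPreserving (E : DirichletForm m) : Prop :=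
  ∀ (f : Lp ℝ 2 m) (u : ℝ → Lp ℝ 2 m), Integrable f m → E.IsHeatFlow f u →
    ∀ t : ℝ, 0 ≤ t → ∫ x, u t x ∂m = ∫ x, f x ∂m

/-- The multilinear form `𝚪₂(f; φ) = ∫ (½ Γ(f) Δφ - Γ(f, Δf) φ)`,
where `Lf` stands for `Δ f` and `Lφ` for `Δ φ`. -/
noncomputable def Gamma2 (E : DirichletForm m)
    (Γ : E.domain →ₗ[ℝ] E.domain →ₗ[ℝ] Lp ℝ 1 m) (f Lf φ : E.domain) (Lφ : Lp ℝ 2 m) : ℝ :=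
  ∫ x, ((1 / 2) * (Γ f f) x * Lφ x - (Γ f Lf) x * (φ : Lp ℝ 2 m) x) ∂m

/-- The Bakry-Émery condition `BE(K, N)`:
`𝚪₂(f; φ) ≥ K ∫ Γ(f) φ + N⁻¹ ∫ (Δf)² φ` for all `f ∈ 𝕍` with `Δf ∈ 𝕍` and all
`φ ∈ 𝕍 ∩ L^∞`, `φ ≥ 0`, with `Δφ ∈ L² ∩ L^∞`. -/
def BakryEmery (E : DirichletForm m) (Γ : E.domain →ₗ[ℝ] E.domain →ₗ[ℝ] Lp ℝ 1 m)
    (K : ℝ) (N : ℝ≥0∞) : Prop :=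
  ∀ (f Lf φ : E.domain) (Lφ : Lp ℝ 2 m),
    E.HasLaplacian f (Lf : Lp ℝ 2 m) → E.HasLaplacian φ Lφ →
    MemLp (φ : Lp ℝ 2 m) ∞ m → MemLp Lφ ∞ m → (∀ᵐ x ∂m, 0 ≤ (φ : Lp ℝ 2 m) x) →
    K * ∫ x, (Γ f f) x * (φ : Lp ℝ 2 m) x ∂m
        + (N⁻¹).toReal * ∫ x, ((Lf : Lp ℝ 2 m) x) ^ 2 * (φ : Lp ℝ 2 m) x ∂m
      ≤ E.Gamma2 Γ f Lf φ Lφ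

/-- The norm of `𝕍`: `‖f‖_𝕍² = ‖f‖²_{L²} + 𝓔(f, f)`. -/
noncomputable def normV (E : DirichletForm m) (f : E.domain) : ℝ :=
  Real.sqrt (‖(f : Lp ℝ 2 m)‖ ^ 2 + E.form f f)

/-- The norm `‖f‖_𝕍 + ‖f - Δf‖_{L²}` of `𝔻 = {f ∈ 𝕍 : Δf ∈ L²}`; `Lf` stands for `Δ f`. -/
noncomputable def normD (E : DirichletForm m) (f : E.domain) (Lf : Lp ℝ 2 m) : ℝ :=
  E.normV f + ‖(f : Lp ℝ 2 m) - Lf‖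

end DirichletForm

/-!
Everything is derived from the resolvents `S = (1 - σ Δ)⁻¹` of the form, which are constructed from
the Riesz representation theorem (`resolvent_spec`). The Markov property makes them preserve
positivity and `L^∞` bounds.

**Bounded Laplacian.** Fix `λ ≥ max (-K) 0` and let `T = (1 - 2 λ σ - σ Δ)⁻¹`. Expanding
`u = S w` and `Tφ` by their equations gives, for bounded `φ ≥ 0` and for `w` in the domain
(first inequality) or `w` bounded (second inequality),
`∫ Γ(S w) φ ≤ ∫ Γ(w) Tφ` (`integral_gamma_resolvent_le`, which is the Bakry-Émery condition) and
`2 σ ∫ Γ(S w) Tφ + ∫ (S w)² φ ≤ ∫ w² Tφ` (`integral_gamma_resolvent_add_le`, which is the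
representation formula of `Γ`). Iterating both, and using that `T` is symmetric, yields a reverse
Poincaré inequality `Γ(Sⁿ⁺¹ g) ≤ ‖g‖_∞² / (2 n σ (1 - 2 λ σ)ⁿ)`, `gamma_resolventIter_le`, the
analogue of `Γ(P_t g) ≤ e^{2 λ t} ‖g‖_∞² / (2 t)` for the heat semigroup.
Up to the term `σ S (Δ f - λ f)`, which vanishes in energy as `σ → 0`, the function `f` is a
multiple of `Sⁿ f` plus a sum of multiples of `Sʲ (Δ f - λ f)`, `2 ≤ j ≤ n`;
letting `σ → 0` with `t = n σ` fixed, one gets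
`√Γ(f) ≤ ‖f‖_∞ / √(2 t) + ‖Δ f - λ f‖_∞ √(2 t)`. The optimal `t` gives
`Γ(f) ≤ 4 ‖f‖_∞ ‖Δ f - λ f‖_∞` (`gamma_le_four_mul`), and `4 ≤ 2 π`. If `Δ f` is bounded but not in
`L²`, this is applied to `S f`, whose Laplacian lies in `L²` and obeys the same bound
(`abs_laplacian_resolvent_le`), and then `σ → 0`.

**Laplacian in `L²`.** This follows as in Marcinkiewicz interpolation. At every level `a > 0`,
`f = u + w` with `Γ(u)` bounded by a multiple of `‖f‖_∞ a`, by the previous case, and with the energy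
of `w` bounded by a multiple of `‖f‖_∞ ∫ (|Δ f - λ f| - a)₊` (`exists_splitting`). Chebyshev's
inequality and integration over the levels bound `∫ Γ(f)²` (`eLpNorm_gamma_two_le`).

**Convergence.** The `L²` estimate for `f n - f'` gives `Γ(f n - f') → 0` in `L²`, and `Γ(f n) → Γ(f')`
follows from the Cauchy-Schwarz inequality for `Γ`.
-/

namespace DirichletForm

variable {X : Type*} [MeasurableSpace X] {m : Measure X}

/-! ### The resolvent -/

/-- The domain of `E`, to be equipped with the inner product `⟪f, g⟫ + σ 𝓔(f, g)`. -/
def EnergySpace (E : DirichletForm m) (_σ : ℝ) : Type _ := E.domain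

namespace EnergySpace

variable (E : DirichletForm m) (σ : ℝ)

instance : AddCommGroup (EnergySpace E σ) := inferInstanceAs (AddCommGroup E.domain)

instance : Module ℝ (EnergySpace E σ) := inferInstanceAs (Module ℝ E.domain)

/-- The identity map from the energy space to the domain of the form. -/
def toDomain : EnergySpace E σ ≃ₗ[ℝ] E.domain := LinearEquiv.refl ℝ E.domain

variable [hσ : Fact (0 < σ)]

/-- The inner product `⟪f, g⟫ + σ 𝓔(f, g)`. -/
noncomputable instance core : InnerProductSpace.Core ℝ (EnergySpace E σ) where
  inner u v := inner ℝ (toDomain E σ u : Lp ℝ 2 m) (toDomain E σ v : Lp ℝ 2 m)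
    + σ * E.form (toDomain E σ u) (toDomain E σ v)
  conj_inner_symm u v := by
    simp only [conj_trivial, E.symm (toDomain E σ v), real_inner_comm]
  re_inner_nonneg u :=
    add_nonneg real_inner_self_nonneg (mul_nonneg hσ.out.le (E.nonneg _))
  add_left u v w := by
    simp only [map_add, Submodule.coe_add, inner_add_left, LinearMap.add_apply]
    ring
  smul_left u v r := by
    simp only [map_smul, Submodule.coe_smul, real_inner_smul_left, LinearMap.smul_apply,
      smul_eq_mul, conj_trivial]
    ring
  definite u hu := by
    have h1 : 0 ≤ inner ℝ (toDomain E σ u : Lp ℝ 2 m) (toDomain E σ u : Lp ℝ 2 m) :=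
      real_inner_self_nonneg
    have h2 := mul_nonneg hσ.out.le (E.nonneg (toDomain E σ u))
    have h3 : inner ℝ (toDomain E σ u : Lp ℝ 2 m) (toDomain E σ u : Lp ℝ 2 m) = 0 := by
      change _ + _ = (0 : ℝ) at hu
      linarith
    have h4 : toDomain E σ u = 0 := Subtype.ext (inner_self_eq_zero.1 h3)
    exact (toDomain E σ).map_eq_zero_iff.1 h4

noncomputable instance : NormedAddCommGroup (EnergySpace E σ) :=
  (core E σ).toNormedAddCommGroup

noncomputable instance : InnerProductSpace ℝ (EnergySpace E σ) :=
  InnerProductSpace.ofCore (core E σ).toCore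

theorem inner_def (u v : EnergySpace E σ) :
    inner ℝ u v = inner ℝ (toDomain E σ u : Lp ℝ 2 m) (toDomain E σ v : Lp ℝ 2 m)
      + σ * E.form (toDomain E σ u) (toDomain E σ v) := rfl

theorem norm_sq (u : EnergySpace E σ) :
    ‖u‖ ^ 2 = ‖(toDomain E σ u : Lp ℝ 2 m)‖ ^ 2 + σ * E.form (toDomain E σ u) (toDomain E σ u) := by
  rw [← real_inner_self_eq_norm_sq, inner_def, real_inner_self_eq_norm_sq]

theorem norm_toDomain_le (u : EnergySpace E σ) : ‖(toDomain E σ u : Lp ℝ 2 m)‖ ≤ ‖u‖ := by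
  refine le_of_sq_le_sq ?_ (norm_nonneg u)
  rw [norm_sq]
  linarith [mul_nonneg hσ.out.le (E.nonneg (toDomain E σ u))]

/-- The inclusion of the energy space into `L²`. -/
noncomputable def inclusion : EnergySpace E σ →L[ℝ] Lp ℝ 2 m :=
  LinearMap.mkContinuous (E.domain.subtype ∘ₗ (toDomain E σ).toLinearMap) 1 fun u => by
    simpa using norm_toDomain_le E σ u

theorem inclusion_apply (u : EnergySpace E σ) :
    inclusion E σ u = (toDomain E σ u : Lp ℝ 2 m) := rfl

/-- Closedness of the form is completeness of the energy space. -/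
instance : CompleteSpace (EnergySpace E σ) := by
  refine Metric.complete_of_cauchySeq_tendsto fun u hu => ?_
  have hL : CauchySeq fun n => inclusion E σ (u n) :=
    (inclusion E σ).uniformContinuous.comp_cauchySeq hu
  obtain ⟨v, hv⟩ := cauchySeq_tendsto_of_complete hL
  obtain ⟨hvd, hlim⟩ := E.closed (fun n => toDomain E σ (u n)) v hv fun ε hε => by
    obtain ⟨N, hN⟩ := Metric.cauchySeq_iff.1 hu (Real.sqrt (σ * ε))
      (Real.sqrt_pos.2 (mul_pos hσ.out hε))
    refine ⟨N, fun i hi j hj => ?_⟩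
    have h1 := hN i hi j hj
    rw [dist_eq_norm, Real.lt_sqrt (norm_nonneg _), norm_sq, map_sub] at h1
    have h2 := sq_nonneg ‖((toDomain E σ (u i) - toDomain E σ (u j) : E.domain) : Lp ℝ 2 m)‖
    exact lt_of_mul_lt_mul_left (by linarith) hσ.out.le
  refine ⟨(toDomain E σ).symm ⟨v, hvd⟩, ?_⟩
  rw [tendsto_iff_norm_sub_tendsto_zero]
  have hsq : Tendsto (fun n => ‖u n - (toDomain E σ).symm ⟨v, hvd⟩‖ ^ 2) atTop (𝓝 0) := by
    have h1 : Tendsto (fun n => ‖(inclusion E σ (u n)) - v‖ ^ 2) atTop (𝓝 0) := by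
      simpa using (tendsto_iff_norm_sub_tendsto_zero.1 hv).pow 2
    have h2 := h1.add (hlim.const_mul σ)
    simp only [mul_zero, add_zero] at h2
    refine h2.congr fun n => ?_
    have h3 : toDomain E σ (u n - (toDomain E σ).symm ⟨v, hvd⟩)
        = toDomain E σ (u n) - ⟨v, hvd⟩ := by
      rw [map_sub, LinearEquiv.apply_symm_apply]
    rw [norm_sq, h3]
    rfl
  have := hsq.sqrt
  simpa [Real.sqrt_sq (norm_nonneg _)] using this

end EnergySpace

open Classical in
/-- The resolvent `(1 - σ Δ)⁻¹` of `E` for `σ > 0`, defined as the adjoint of the inclusion of the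
energy space into `L²`. For `σ ≤ 0` the value is `0`. -/
noncomputable def resolvent (E : DirichletForm m) (σ : ℝ) : Lp ℝ 2 m →ₗ[ℝ] E.domain :=
  if hσ : 0 < σ then
    haveI := Fact.mk hσ
    (EnergySpace.toDomain E σ).toLinearMap ∘ₗ
      (ContinuousLinearMap.adjoint (EnergySpace.inclusion E σ)).toLinearMap
  else 0

section Resolvent

variable (E : DirichletForm m) {σ : ℝ}

theorem resolvent_apply [hσ : Fact (0 < σ)] (g : Lp ℝ 2 m) : E.resolvent σ g =
    EnergySpace.toDomain E σ (ContinuousLinearMap.adjoint (EnergySpace.inclusion E σ) g) := by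
  rw [resolvent, dif_pos hσ.out]
  rfl

/-- The weak form of the equation `u - σ Δ u = g` solved by the resolvent. -/
theorem resolvent_spec (hσ : 0 < σ) (g : Lp ℝ 2 m) (v : E.domain) :
    inner ℝ (E.resolvent σ g : Lp ℝ 2 m) (v : Lp ℝ 2 m) + σ * E.form (E.resolvent σ g) v
      = inner ℝ g (v : Lp ℝ 2 m) := by
  have := Fact.mk hσ
  have h := ContinuousLinearMap.adjoint_inner_left (EnergySpace.inclusion E σ)
    ((EnergySpace.toDomain E σ).symm v) g
  rw [EnergySpace.inner_def, EnergySpace.inclusion_apply, LinearEquiv.apply_symm_apply] at h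
  rw [resolvent_apply]
  exact h

/-- The range of the resolvent is dense in the domain, for the norm of the energy space: the
inclusion of which the resolvent is the adjoint is injective. -/
theorem exists_resolvent_near (hσ : 0 < σ) (f : E.domain) {ε : ℝ} (hε : 0 < ε) :
    ∃ k : Lp ℝ 2 m, ‖((f - E.resolvent σ k : E.domain) : Lp ℝ 2 m)‖ ^ 2
      + σ * E.form (f - E.resolvent σ k) (f - E.resolvent σ k) < ε := by
  have := Fact.mk hσ
  set T := ContinuousLinearMap.adjoint (EnergySpace.inclusion E σ) with hT
  have hker : T.rangeᗮ = ⊥ := by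
    rw [T.orthogonal_range, hT, ContinuousLinearMap.adjoint_adjoint, LinearMap.ker_eq_bot]
    intro a b hab
    exact (EnergySpace.toDomain E σ).injective (Subtype.ext hab)
  have hdense := (Submodule.topologicalClosure_eq_top_iff).2 hker
  have hmem : (EnergySpace.toDomain E σ).symm f ∈ closure (T.range : Set (EnergySpace E σ)) := by
    rw [← Submodule.topologicalClosure_coe, hdense]
    trivial
  obtain ⟨_, ⟨k, rfl⟩, hk⟩ := Metric.mem_closure_iff.1 hmem (Real.sqrt ε) (Real.sqrt_pos.2 hε)
  refine ⟨k, ?_⟩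
  rw [resolvent_apply]
  rw [dist_eq_norm, Real.lt_sqrt (norm_nonneg _), EnergySpace.norm_sq, map_sub,
    LinearEquiv.apply_symm_apply] at hk
  exact hk

/-! ### Laplacians -/

theorem inner_eq_integral_mul (f g : Lp ℝ 2 m) : inner ℝ f g = ∫ x, f x * g x ∂m := by
  rw [MeasureTheory.L2.inner_def]
  refine integral_congr_ae (.of_forall fun x => ?_)
  simp [mul_comm]

theorem integrable_mul (f g : Lp ℝ 2 m) : Integrable (fun x => f x * g x) m :=
  (Lp.memLp f).integrable_mul (Lp.memLp g)

theorem hasLaplacian_iff {f : E.domain} {L : Lp ℝ 2 m} :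
    E.HasLaplacian f L ↔ ∀ g : E.domain, -E.form f g = inner ℝ L (g : Lp ℝ 2 m) := by
  simp only [HasLaplacian, integrable_mul, inner_eq_integral_mul, forall_const]

theorem HasLaplacian.congr {f : E.domain} {h k : X → ℝ} (hf : E.HasLaplacian f h)
    (hk : h =ᵐ[m] k) : E.HasLaplacian f k := by
  intro g hg
  have h1 : (fun x => h x * (g : Lp ℝ 2 m) x) =ᵐ[m] fun x => k x * (g : Lp ℝ 2 m) x := by
    filter_upwards [hk] with x hx
    rw [hx]
  rw [hf g (hg.congr h1.symm), integral_congr_ae h1]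

theorem HasLaplacian.sub {f g : E.domain} {L M : Lp ℝ 2 m} (hf : E.HasLaplacian f L)
    (hg : E.HasLaplacian g M) : E.HasLaplacian (f - g) (L - M : Lp ℝ 2 m) := by
  rw [hasLaplacian_iff] at *
  intro v
  rw [map_sub, LinearMap.sub_apply, inner_sub_left, ← hf, ← hg]
  ring

theorem HasLaplacian.smul {f : E.domain} {L : Lp ℝ 2 m} (hf : E.HasLaplacian f L) (r : ℝ) :
    E.HasLaplacian (r • f) (r • L : Lp ℝ 2 m) := by
  rw [hasLaplacian_iff] at *
  intro v
  rw [map_smul, LinearMap.smul_apply, real_inner_smul_left, ← hf, smul_eq_mul]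
  ring

theorem hasLaplacian_resolvent (hσ : 0 < σ) (g : Lp ℝ 2 m) :
    E.HasLaplacian (E.resolvent σ g) (σ⁻¹ • ((E.resolvent σ g : Lp ℝ 2 m) - g) : Lp ℝ 2 m) := by
  rw [hasLaplacian_iff]
  intro v
  rw [real_inner_smul_left, inner_sub_left, ← E.resolvent_spec hσ g v]
  field_simp
  ring

/-- The variational characterization of the resolvent: `u = (1 - σ Δ)⁻¹ g` minimizes
`v ↦ ‖v - g‖² + σ 𝓔(v, v)`, with the excess given by the energy norm of `v - u`. -/
theorem resolvent_variational (hσ : 0 < σ) (g : Lp ℝ 2 m) (v : E.domain) :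
    ‖(v : Lp ℝ 2 m) - g‖ ^ 2 + σ * E.form v v
      = ‖(E.resolvent σ g : Lp ℝ 2 m) - g‖ ^ 2 + σ * E.form (E.resolvent σ g) (E.resolvent σ g)
        + ‖(v : Lp ℝ 2 m) - E.resolvent σ g‖ ^ 2
        + σ * E.form (v - E.resolvent σ g) (v - E.resolvent σ g) := by
  have h := E.resolvent_spec hσ g (v - E.resolvent σ g)
  set u := E.resolvent σ g
  have hs := E.symm u v
  simp only [Submodule.coe_sub, inner_sub_right, map_sub, LinearMap.sub_apply,
    ← real_inner_self_eq_norm_sq, inner_sub_left] at h ⊢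
  rw [real_inner_comm (v : Lp ℝ 2 m) g, real_inner_comm (u : Lp ℝ 2 m) g] at h ⊢
  rw [real_inner_comm (v : Lp ℝ 2 m) (u : Lp ℝ 2 m)] at h ⊢
  rw [hs] at h ⊢
  linarith

theorem resolvent_unique (hσ : 0 < σ) {u : E.domain} {L g : Lp ℝ 2 m} (hu : E.HasLaplacian u L)
    (hg : (u : Lp ℝ 2 m) - σ • L = g) : E.resolvent σ g = u := by
  rw [hasLaplacian_iff] at hu
  set v := E.resolvent σ g - u with hv
  have h1 := E.resolvent_spec hσ g v
  have h2 := hu v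
  have h3 : inner ℝ (v : Lp ℝ 2 m) (v : Lp ℝ 2 m) + σ * E.form v v = 0 := by
    rw [← hg, inner_sub_left, real_inner_smul_left, ← h2] at h1
    have h4 : E.resolvent σ g = v + u := by rw [hv]; abel
    rw [← hg] at h4
    rw [h4, Submodule.coe_add, inner_add_left, map_add, LinearMap.add_apply] at h1
    linarith
  have h5 := mul_nonneg hσ.le (E.nonneg v)
  have h6 : inner ℝ (v : Lp ℝ 2 m) (v : Lp ℝ 2 m) = 0 :=
    le_antisymm (by linarith) real_inner_self_nonneg
  exact sub_eq_zero.1 (Subtype.ext (inner_self_eq_zero.1 h6))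

theorem inner_resolvent_left (hσ : 0 < σ) (a b : Lp ℝ 2 m) :
    inner ℝ (E.resolvent σ a : Lp ℝ 2 m) b = inner ℝ a (E.resolvent σ b : Lp ℝ 2 m) := by
  have h1 := E.resolvent_spec hσ a (E.resolvent σ b)
  have h2 := E.resolvent_spec hσ b (E.resolvent σ a)
  rw [E.symm, real_inner_comm] at h2
  rw [← h1, real_inner_comm b, ← h2]

/-- Stability of the resolvent under a normal contraction `η` that brings its values closer to
the right-hand side. -/
theorem resolvent_eq_of_contraction (hσ : 0 < σ) (g : Lp ℝ 2 m) {η : ℝ → ℝ}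
    (hη : LipschitzWith 1 η) (h0 : η 0 = 0)
    (hg : ∀ᵐ x ∂m, |η ((E.resolvent σ g : Lp ℝ 2 m) x) - g x|
      ≤ |(E.resolvent σ g : Lp ℝ 2 m) x - g x|) :
    ∀ᵐ x ∂m, η ((E.resolvent σ g : Lp ℝ 2 m) x) = (E.resolvent σ g : Lp ℝ 2 m) x := by
  obtain ⟨hmem, hle⟩ := E.markov η hη h0 (E.resolvent σ g)
  have h1 := E.resolvent_variational hσ g ⟨_, hmem⟩
  have hco := hη.coeFn_compLp h0 (E.resolvent σ g : Lp ℝ 2 m)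
  have h2 : ‖hη.compLp h0 (E.resolvent σ g : Lp ℝ 2 m) - g‖
      ≤ ‖(E.resolvent σ g : Lp ℝ 2 m) - g‖ := by
    refine Lp.norm_le_norm_of_ae_le ?_
    filter_upwards [hg, hco, Lp.coeFn_sub (hη.compLp h0 (E.resolvent σ g : Lp ℝ 2 m)) g,
      Lp.coeFn_sub (E.resolvent σ g : Lp ℝ 2 m) g] with x h1 h2 h3 h4
    rw [h3, h4, Pi.sub_apply, Pi.sub_apply, h2]
    exact h1
  have h3 := pow_le_pow_left₀ (norm_nonneg _) h2 2
  have h4 := mul_le_mul_of_nonneg_left hle hσ.le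
  have h5 := mul_nonneg hσ.le
    (E.nonneg (⟨_, hmem⟩ - E.resolvent σ g))
  have h6 : ‖hη.compLp h0 (E.resolvent σ g : Lp ℝ 2 m) - E.resolvent σ g‖ ^ 2 = 0 :=
    le_antisymm (by linarith) (sq_nonneg _)
  have h7 : hη.compLp h0 (E.resolvent σ g : Lp ℝ 2 m) = E.resolvent σ g :=
    sub_eq_zero.1 (norm_eq_zero.1 (pow_eq_zero_iff two_ne_zero |>.1 h6))
  filter_upwards [hco] with x hx
  rw [← Function.comp_apply (f := η), ← hx, h7]

theorem resolvent_nonneg (hσ : 0 < σ) {g : Lp ℝ 2 m} (hg : ∀ᵐ x ∂m, 0 ≤ g x) :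
    ∀ᵐ x ∂m, 0 ≤ (E.resolvent σ g : Lp ℝ 2 m) x := by
  have hη : LipschitzWith 1 fun x : ℝ => max x 0 := LipschitzWith.id.max_const 0
  filter_upwards [E.resolvent_eq_of_contraction hσ g hη (by simp) (by
    filter_upwards [hg] with x hx
    rcases le_total 0 ((E.resolvent σ g : Lp ℝ 2 m) x) with h | h
    · rw [max_eq_left h]
    · rw [max_eq_right h, abs_of_nonpos (by linarith), abs_of_nonpos (by linarith)]
      linarith)] with x hx
  rw [← hx]
  exact le_max_right _ _

/-- Truncation at levels `±M`. -/
noncomputable def clip (M x : ℝ) : ℝ := max (-M) (min x M)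

theorem lipschitzWith_clip (M : ℝ) : LipschitzWith 1 (clip M) :=
  (LipschitzWith.id.min_const M).const_max (-M)

theorem clip_zero {M : ℝ} (hM : 0 ≤ M) : clip M 0 = 0 := by
  simp [clip, hM]

theorem abs_clip_le {M : ℝ} (hM : 0 ≤ M) (x : ℝ) : |clip M x| ≤ M :=
  abs_le.2 ⟨le_max_left _ _, max_le (by linarith) (min_le_right _ _)⟩

theorem clip_of_abs_le {M x : ℝ} (hx : |x| ≤ M) : clip M x = x := by
  rw [clip, min_eq_left (abs_le.1 hx).2, max_eq_right (abs_le.1 hx).1]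

theorem abs_sub_clip (M : ℝ) (hM : 0 ≤ M) (x : ℝ) : |x - clip M x| = max (|x| - M) 0 := by
  unfold clip
  rcases le_total x M with h | h <;> rcases le_total (-M) x with h' | h' <;>
  rcases le_total 0 x with h'' | h'' <;>
  grind

theorem abs_resolvent_le (hσ : 0 < σ) {g : Lp ℝ 2 m} {M : ℝ} (hM : 0 ≤ M)
    (hg : ∀ᵐ x ∂m, |g x| ≤ M) : ∀ᵐ x ∂m, |(E.resolvent σ g : Lp ℝ 2 m) x| ≤ M := by
  filter_upwards [E.resolvent_eq_of_contraction hσ g (lipschitzWith_clip M) (clip_zero hM) (by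
    filter_upwards [hg] with x hx
    set u := (E.resolvent σ g : Lp ℝ 2 m) x
    have := abs_le.1 hx
    unfold clip
    rcases le_total u M with h | h
    · rw [min_eq_left h]
      rcases le_total (-M) u with h' | h'
      · rw [max_eq_right h']
      · rw [max_eq_left h', abs_of_nonpos (by linarith), abs_of_nonpos (by linarith)]
        linarith
    · rw [min_eq_right h, max_eq_right (by linarith), abs_of_nonneg (by linarith),
        abs_of_nonneg (by linarith)]
      linarith)] with x hx
  rw [← hx]
  exact abs_clip_le hM _

/-! ### Bounded functions in the domain form an algebra -/

theorem exists_sq_mem {u : E.domain} {M : ℝ} (hM : 0 < M)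
    (hu : ∀ᵐ x ∂m, |(u : Lp ℝ 2 m) x| ≤ M) :
    ∃ w : E.domain, ∀ᵐ x ∂m, (w : Lp ℝ 2 m) x = (u : Lp ℝ 2 m) x * (u : Lp ℝ 2 m) x := by
  -- `x ↦ (clip x)² / (2 M)` is a normal contraction
  have hη : LipschitzWith 1 fun x : ℝ => (2 * M)⁻¹ * (clip M x * clip M x) := by
    refine LipschitzWith.of_dist_le_mul fun x y => ?_
    have h1 := (lipschitzWith_clip M).dist_le_mul x y
    simp only [Real.dist_eq, NNReal.coe_one, one_mul] at h1 ⊢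
    have h2 := abs_clip_le hM.le x
    have h3 := abs_clip_le hM.le y
    have h4 : (2 * M)⁻¹ * (clip M x * clip M x) - (2 * M)⁻¹ * (clip M y * clip M y)
        = (2 * M)⁻¹ * ((clip M x + clip M y) * (clip M x - clip M y)) := by ring
    rw [h4, abs_mul, abs_mul, abs_of_pos (by positivity : 0 < (2 * M)⁻¹),
      inv_mul_le_iff₀ (by positivity)]
    exact mul_le_mul ((abs_add_le _ _).trans (by linarith)) h1 (abs_nonneg _) (by positivity)
  have h0 : (2 * M)⁻¹ * (clip M 0 * clip M 0) = 0 := by rw [clip_zero hM.le]; simp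
  obtain ⟨hmem, -⟩ := E.markov _ hη h0 u
  refine ⟨(2 * M) • ⟨_, hmem⟩, ?_⟩
  filter_upwards [hu, hη.coeFn_compLp h0 (u : Lp ℝ 2 m),
    Lp.coeFn_smul (2 * M) (hη.compLp h0 (u : Lp ℝ 2 m))] with x h1 h2 h3
  rw [Submodule.coe_smul, h3, Pi.smul_apply, h2, Function.comp_apply, clip_of_abs_le h1,
    smul_eq_mul, mul_inv_cancel_left₀ (by positivity)]

theorem exists_mul_mem {u v : E.domain} {M N : ℝ} (hM : 0 < M) (hN : 0 < N)
    (hu : ∀ᵐ x ∂m, |(u : Lp ℝ 2 m) x| ≤ M) (hv : ∀ᵐ x ∂m, |(v : Lp ℝ 2 m) x| ≤ N) :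
    ∃ w : E.domain, ∀ᵐ x ∂m, (w : Lp ℝ 2 m) x = (u : Lp ℝ 2 m) x * (v : Lp ℝ 2 m) x := by
  have hadd := Lp.coeFn_add (u : Lp ℝ 2 m) v
  have hsub := Lp.coeFn_sub (u : Lp ℝ 2 m) v
  obtain ⟨a, ha⟩ := E.exists_sq_mem (u := u + v) (M := M + N) (by positivity) (by
    filter_upwards [hu, hv, hadd] with x h1 h2 h3
    rw [Submodule.coe_add, h3]
    exact (abs_add_le _ _).trans (add_le_add h1 h2))
  obtain ⟨b, hb⟩ := E.exists_sq_mem (u := u - v) (M := M + N) (by positivity) (by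
    filter_upwards [hu, hv, hsub] with x h1 h2 h3
    rw [Submodule.coe_sub, h3]
    exact (abs_sub _ _).trans (add_le_add h1 h2))
  refine ⟨(1 / 4 : ℝ) • (a - b), ?_⟩
  filter_upwards [hadd, hsub, ha, hb, Lp.coeFn_smul (1 / 4 : ℝ) ((a : Lp ℝ 2 m) - (b : Lp ℝ 2 m)),
    Lp.coeFn_sub (a : Lp ℝ 2 m) (b : Lp ℝ 2 m)] with x h1 h2 h3 h4 h5 h6
  rw [Submodule.coe_smul, Submodule.coe_sub, h5, Pi.smul_apply, h6, Pi.sub_apply, h3, h4,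
    Submodule.coe_add, Submodule.coe_sub, h1, h2, Pi.add_apply, Pi.sub_apply, smul_eq_mul]
  ring

end Resolvent

/-! ### Pointwise calculus of the carré du champ -/

theorem integrable_mul_of_bounded {F : X → ℝ} (hF : Integrable F m) (φ : Lp ℝ 2 m) {M : ℝ}
    (hφ : ∀ᵐ x ∂m, |φ x| ≤ M) : Integrable (fun x => F x * φ x) m :=
  hF.mul_bdd (c := M) (Lp.memLp φ).1 hφ

theorem memLp_top_of_abs_le {φ : Lp ℝ 2 m} {M : ℝ} (hφ : ∀ᵐ x ∂m, |φ x| ≤ M) : MemLp φ ∞ m :=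
  memLp_top_of_bound (Lp.memLp φ).1 M hφ

variable {E : DirichletForm m} {Γ : E.domain →ₗ[ℝ] E.domain →ₗ[ℝ] Lp ℝ 1 m}

theorem integrable_gamma (u v : E.domain) : Integrable (Γ u v) m := L1.integrable_coeFn _

theorem IsCarreDuChamp.gamma_add_smul (hΓ : E.IsCarreDuChamp Γ) (u v : E.domain) (t : ℝ) :
    ∀ᵐ x ∂m, Γ (u + t • v) (u + t • v) x = Γ u u x + 2 * t * Γ u v x + t ^ 2 * Γ v v x := by
  have h : Γ (u + t • v) (u + t • v) = Γ u u + (2 * t) • Γ u v + (t ^ 2) • Γ v v := by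
    simp only [map_add, map_smul, LinearMap.add_apply, LinearMap.smul_apply, hΓ.symm v u]
    module
  rw [h]
  filter_upwards [Lp.coeFn_add (Γ u u + (2 * t) • Γ u v) ((t ^ 2) • Γ v v),
    Lp.coeFn_add (Γ u u) ((2 * t) • Γ u v), Lp.coeFn_smul (2 * t) (Γ u v),
    Lp.coeFn_smul (t ^ 2) (Γ v v)] with x h1 h2 h3 h4
  rw [h1, Pi.add_apply, h2, Pi.add_apply, h3, h4]
  rfl

theorem gamma_smul (u : E.domain) (t : ℝ) : ∀ᵐ x ∂m, Γ (t • u) (t • u) x = t ^ 2 * Γ u u x := by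
  have h : Γ (t • u) (t • u) = (t ^ 2) • Γ u u := by
    simp only [map_smul, LinearMap.smul_apply]
    module
  rw [h]
  exact Lp.coeFn_smul (t ^ 2) (Γ u u)

/-- The pointwise Cauchy-Schwarz inequality: almost everywhere, the quadratic polynomial
`t ↦ Γ(u + t v)` is nonnegative at all rational `t`, hence at all real `t`. -/
theorem IsCarreDuChamp.cauchySchwarz (hΓ : E.IsCarreDuChamp Γ) (u v : E.domain) :
    ∀ᵐ x ∂m, Γ u v x ^ 2 ≤ Γ u u x * Γ v v x := by
  have hq : ∀ᵐ x ∂m, ∀ q : ℚ, 0 ≤ Γ u u x + 2 * (q : ℝ) * Γ u v x + (q : ℝ) ^ 2 * Γ v v x := by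
    rw [ae_all_iff]
    intro q
    filter_upwards [hΓ.gamma_add_smul u v q, hΓ.nonneg (u + (q : ℝ) • v)] with x h1 h2
    rwa [← h1]
  filter_upwards [hq] with x hx
  have hr : ∀ t : ℝ, 0 ≤ Γ v v x * (t * t) + 2 * Γ u v x * t + Γ u u x := by
    intro t
    have hcl : IsClosed {t : ℝ | 0 ≤ Γ v v x * (t * t) + 2 * Γ u v x * t + Γ u u x} :=
      isClosed_le continuous_const (by fun_prop)
    have hsub : Set.range ((↑) : ℚ → ℝ)
        ⊆ {t : ℝ | 0 ≤ Γ v v x * (t * t) + 2 * Γ u v x * t + Γ u u x} := by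
      rintro _ ⟨q, rfl⟩
      have := hx q
      simp only [Set.mem_ofPred_eq]
      linarith
    exact hcl.closure_subset_iff.2 hsub (Rat.denseRange_cast t)
  have := discrim_le_zero hr
  rw [discrim] at this
  linarith

/-- Young's form of the pointwise Cauchy-Schwarz inequality. -/
theorem IsCarreDuChamp.two_abs_gamma_le (hΓ : E.IsCarreDuChamp Γ) (u v : E.domain) {δ : ℝ}
    (hδ : 0 < δ) : ∀ᵐ x ∂m, 2 * |Γ u v x| ≤ δ * Γ u u x + δ⁻¹ * Γ v v x := by
  filter_upwards [hΓ.cauchySchwarz u v, hΓ.nonneg u, hΓ.nonneg v] with x h1 h2 h3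
  have hi : 0 < δ⁻¹ := inv_pos.2 hδ
  refine abs_le_of_sq_le_sq' (a := 2 * |Γ u v x|) ?_ (by positivity) |>.2
  have h4 : δ * δ⁻¹ = 1 := mul_inv_cancel₀ hδ.ne'
  have h5 : (δ * Γ u u x + δ⁻¹ * Γ v v x) ^ 2
      = (δ * Γ u u x - δ⁻¹ * Γ v v x) ^ 2 + 4 * (δ * δ⁻¹) * (Γ u u x * Γ v v x) := by ring
  rw [h5, h4, mul_pow, sq_abs]
  nlinarith [sq_nonneg (δ * Γ u u x - δ⁻¹ * Γ v v x)]

theorem IsCarreDuChamp.gamma_add_le_young (hΓ : E.IsCarreDuChamp Γ) (u v : E.domain) {δ : ℝ}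
    (hδ : 0 < δ) : ∀ᵐ x ∂m, Γ (u + v) (u + v) x ≤ (1 + δ) * Γ u u x + (1 + δ⁻¹) * Γ v v x := by
  have h := hΓ.gamma_add_smul u v 1
  rw [one_smul] at h
  filter_upwards [h, hΓ.two_abs_gamma_le u v hδ] with x h1 h2
  rw [h1]
  linarith [le_abs_self (Γ u v x)]

/-- The triangle inequality for `√Γ`, for functions whose `√Γ` is bounded. -/
theorem IsCarreDuChamp.gamma_add_le_sq (hΓ : E.IsCarreDuChamp Γ) {u v : E.domain} {a b : ℝ}
    (ha : 0 ≤ a) (hb : 0 ≤ b) (hu : ∀ᵐ x ∂m, Γ u u x ≤ a ^ 2) (hv : ∀ᵐ x ∂m, Γ v v x ≤ b ^ 2) :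
    ∀ᵐ x ∂m, Γ (u + v) (u + v) x ≤ (a + b) ^ 2 := by
  have h := hΓ.gamma_add_smul u v 1
  rw [one_smul] at h
  filter_upwards [h, hΓ.cauchySchwarz u v, hu, hv, hΓ.nonneg u, hΓ.nonneg v]
    with x h1 h2 h3 h4 h5 h6
  have h7 : Γ u v x ^ 2 ≤ (a * b) ^ 2 :=
    h2.trans ((mul_le_mul h3 h4 h6 (sq_nonneg a)).trans_eq (mul_pow a b 2).symm)
  have h8 := (abs_le_of_sq_le_sq' h7 (mul_nonneg ha hb)).2
  rw [h1]
  nlinarith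

/-- Pointwise bounds on `Γ` pass to limits in energy. -/
theorem IsCarreDuChamp.gamma_le_of_tendsto [SigmaFinite m] (hΓ : E.IsCarreDuChamp Γ)
    {f : E.domain} {u : ℕ → E.domain} {B : ℕ → ℝ} {b : ℝ}
    (hu : Tendsto (fun n => E.form (u n - f) (u n - f)) atTop (𝓝 0))
    (hB : Tendsto B atTop (𝓝 b)) (hle : ∀ᶠ n in atTop, ∀ᵐ x ∂m, Γ (u n) (u n) x ≤ B n) :
    ∀ᵐ x ∂m, Γ f f x ≤ b := by
  suffices h : 0 ≤ᵐ[m] fun x => b - Γ f f x by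
    filter_upwards [h] with x hx
    exact sub_nonneg.1 hx
  refine ae_nonneg_of_forall_setIntegral_nonneg_of_sigmaFinite
    (fun s _ hs => (integrableOn_const hs.ne).sub (integrable_gamma f f).integrableOn) ?_
  intro s hs hms
  have hc : ∀ c : ℝ, Integrable (fun _ => c) (m.restrict s) :=
    fun c => integrableOn_const hms.ne
  rw [integral_sub (hc b) (integrable_gamma f f).integrableOn, sub_nonneg,
    setIntegral_const, smul_eq_mul]
  have hδ : ∀ δ : ℝ, 0 < δ → ∫ x in s, Γ f f x ∂m ≤ (1 + δ) * (m.real s * b) := by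
    intro δ hδ
    have hlim : Tendsto (fun n => (1 + δ) * (m.real s * B n)
        + (1 + δ⁻¹) * E.form (u n - f) (u n - f)) atTop (𝓝 ((1 + δ) * (m.real s * b))) := by
      have := ((hB.const_mul (m.real s)).const_mul (1 + δ)).add (hu.const_mul (1 + δ⁻¹))
      simpa using this
    refine ge_of_tendsto hlim ?_
    filter_upwards [hle] with n hn
    have hy := hΓ.gamma_add_le_young (u n) (-(u n - f)) hδ
    have h1 : u n + -(u n - f) = f := by abel
    have h2 : Γ (-(u n - f)) (-(u n - f)) = Γ (u n - f) (u n - f) := by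
      rw [map_neg, map_neg, LinearMap.neg_apply, neg_neg]
    rw [h1, h2] at hy
    have hint : Integrable (fun x => (1 + δ⁻¹) * Γ (u n - f) (u n - f) x) m :=
      (integrable_gamma _ _).const_mul _
    calc ∫ x in s, Γ f f x ∂m
        ≤ ∫ x in s, ((1 + δ) * B n + (1 + δ⁻¹) * Γ (u n - f) (u n - f) x) ∂m := by
          refine integral_mono_ae (integrable_gamma f f).integrableOn
            ((hc _).add hint.integrableOn) (ae_restrict_of_ae ?_)
          filter_upwards [hy, hn] with x h3 h4
          have := mul_le_mul_of_nonneg_left h4 (by positivity : 0 ≤ 1 + δ)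
          linarith
      _ = (1 + δ) * (m.real s * B n) + ∫ x in s, (1 + δ⁻¹) * Γ (u n - f) (u n - f) x ∂m := by
          rw [integral_add (hc _) hint.integrableOn, setIntegral_const,
            smul_eq_mul]
          ring
      _ ≤ (1 + δ) * (m.real s * B n) + ∫ x, (1 + δ⁻¹) * Γ (u n - f) (u n - f) x ∂m := by
          refine add_le_add_right (setIntegral_le_integral hint ?_) _
          filter_upwards [hΓ.nonneg (u n - f)] with x hx
          exact mul_nonneg (by positivity) hx
      _ = _ := by rw [integral_const_mul, ← hΓ.energy]
  have hlim : Tendsto (fun δ : ℝ => (1 + δ) * (m.real s * b)) (𝓝[>] 0)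
      (𝓝 ((1 + 0) * (m.real s * b))) :=
    tendsto_nhdsWithin_of_tendsto_nhds (Continuous.tendsto (by fun_prop) 0)
  rw [add_zero, one_mul] at hlim
  exact ge_of_tendsto hlim (by filter_upwards [self_mem_nhdsWithin] with δ h using hδ δ h)

/-! ### Resolvent form of the reverse Poincaré inequality -/

/-- The operator `(θ - σ Δ)⁻¹`, for `θ, σ > 0`. -/
noncomputable def shiftedResolvent (E : DirichletForm m) (σ θ : ℝ) (φ : Lp ℝ 2 m) : E.domain :=
  θ⁻¹ • E.resolvent (σ / θ) φ

section shiftedResolvent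

variable (E) {σ θ : ℝ} (hσ : 0 < σ) (hθ : 0 < θ)

include hσ hθ

theorem hasLaplacian_shiftedResolvent (φ : Lp ℝ 2 m) :
    E.HasLaplacian (E.shiftedResolvent σ θ φ)
      (σ⁻¹ • (θ • (E.shiftedResolvent σ θ φ : Lp ℝ 2 m) - φ) : Lp ℝ 2 m) := by
  have h := (E.hasLaplacian_resolvent (div_pos hσ hθ) φ).smul E θ⁻¹
  have h2 : (σ⁻¹ • (θ • (E.shiftedResolvent σ θ φ : Lp ℝ 2 m) - φ) : Lp ℝ 2 m)
      = θ⁻¹ • ((σ / θ)⁻¹ • ((E.resolvent (σ / θ) φ : Lp ℝ 2 m) - φ)) := by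
    rw [shiftedResolvent, Submodule.coe_smul, smul_inv_smul₀ hθ.ne', smul_smul]
    congr 1
    field_simp
  rw [h2]
  exact h

theorem shiftedResolvent_nonneg {φ : Lp ℝ 2 m} (hφ : ∀ᵐ x ∂m, 0 ≤ φ x) :
    ∀ᵐ x ∂m, 0 ≤ (E.shiftedResolvent σ θ φ : Lp ℝ 2 m) x := by
  filter_upwards [E.resolvent_nonneg (div_pos hσ hθ) hφ,
    Lp.coeFn_smul θ⁻¹ (E.resolvent (σ / θ) φ : Lp ℝ 2 m)] with x h1 h2
  rw [shiftedResolvent, Submodule.coe_smul, h2]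
  exact mul_nonneg (inv_nonneg.2 hθ.le) h1

theorem abs_shiftedResolvent_le {φ : Lp ℝ 2 m} {M : ℝ} (hM : 0 ≤ M) (hφ : ∀ᵐ x ∂m, |φ x| ≤ M) :
    ∀ᵐ x ∂m, |(E.shiftedResolvent σ θ φ : Lp ℝ 2 m) x| ≤ θ⁻¹ * M := by
  filter_upwards [E.abs_resolvent_le (div_pos hσ hθ) hM hφ,
    Lp.coeFn_smul θ⁻¹ (E.resolvent (σ / θ) φ : Lp ℝ 2 m)] with x h1 h2
  rw [shiftedResolvent, Submodule.coe_smul, h2, Pi.smul_apply, smul_eq_mul, abs_mul,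
    abs_of_pos (inv_pos.2 hθ)]
  exact mul_le_mul_of_nonneg_left h1 (inv_nonneg.2 hθ.le)

theorem inner_shiftedResolvent_left (a b : Lp ℝ 2 m) :
    inner ℝ (E.shiftedResolvent σ θ a : Lp ℝ 2 m) b
      = inner ℝ a (E.shiftedResolvent σ θ b : Lp ℝ 2 m) := by
  rw [shiftedResolvent, shiftedResolvent, Submodule.coe_smul, Submodule.coe_smul,
    real_inner_smul_left, real_inner_smul_right, E.inner_resolvent_left (div_pos hσ hθ)]

end shiftedResolvent

theorem coeFn_sub_smul {p : ℝ≥0∞} (a b : Lp ℝ p m) (r : ℝ) :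
    ∀ᵐ x ∂m, (a - r • b : Lp ℝ p m) x = a x - r * b x := by
  filter_upwards [Lp.coeFn_sub a (r • b), Lp.coeFn_smul r b] with x h1 h2
  rw [h1, Pi.sub_apply, h2]
  rfl

theorem coeFn_smul_sub {p : ℝ≥0∞} (a b : Lp ℝ p m) (r : ℝ) :
    ∀ᵐ x ∂m, (r • (a - b) : Lp ℝ p m) x = r * (a x - b x) := by
  filter_upwards [Lp.coeFn_sub a b, Lp.coeFn_smul r (a - b)] with x h1 h2
  rw [h2, Pi.smul_apply, h1]
  rfl

/-- The Laplacian of `shiftedResolvent`, pointwise: `φ = θ φ' - σ Δ φ'`. -/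
theorem coeFn_laplacian_shiftedResolvent {σ θ : ℝ} (hσ : 0 < σ) (φ' φ : Lp ℝ 2 m) :
    ∀ᵐ x ∂m, φ x = θ * φ' x - σ * (σ⁻¹ • (θ • φ' - φ) : Lp ℝ 2 m) x := by
  filter_upwards [Lp.coeFn_smul σ⁻¹ (θ • φ' - φ), Lp.coeFn_sub (θ • φ') φ,
    Lp.coeFn_smul θ φ'] with x h1 h2 h3
  rw [h1, Pi.smul_apply, h2, Pi.sub_apply, h3, Pi.smul_apply, smul_eq_mul, smul_eq_mul,
    mul_inv_cancel_left₀ hσ.ne']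
  ring

theorem abs_laplacian_shiftedResolvent_le {σ θ : ℝ} (hσ : 0 < σ) {φ' φ : Lp ℝ 2 m} {M N : ℝ}
    (hφ' : ∀ᵐ x ∂m, |φ' x| ≤ N) (hφ : ∀ᵐ x ∂m, |φ x| ≤ M) :
    ∀ᵐ x ∂m, |(σ⁻¹ • (θ • φ' - φ) : Lp ℝ 2 m) x| ≤ σ⁻¹ * (|θ| * N + M) := by
  filter_upwards [Lp.coeFn_smul σ⁻¹ (θ • φ' - φ), Lp.coeFn_sub (θ • φ') φ,
    Lp.coeFn_smul θ φ', hφ', hφ] with x h1 h2 h3 h4 h5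
  rw [h1, Pi.smul_apply, h2, Pi.sub_apply, h3, Pi.smul_apply, smul_eq_mul, smul_eq_mul, abs_mul,
    abs_of_pos (inv_pos.2 hσ)]
  refine mul_le_mul_of_nonneg_left ((abs_sub _ _).trans (add_le_add ?_ h5)) (inv_pos.2 hσ).le
  rw [abs_mul]
  exact mul_le_mul_of_nonneg_left h4 (abs_nonneg θ)

theorem integral_sub_mul_add_mul {a b c : X → ℝ} (ha : Integrable a m) (hb : Integrable b m)
    (hc : Integrable c m) (s t : ℝ) : ∫ x, (a x - s * b x + t * c x) ∂m
      = ∫ x, a x ∂m - s * ∫ x, b x ∂m + t * ∫ x, c x ∂m := by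
  rw [integral_add (f := fun x => a x - s * b x) (ha.sub (hb.const_mul s)) (hc.const_mul t),
    integral_sub ha (hb.const_mul s), integral_const_mul, integral_const_mul]

/-- The gradient estimate for one resolvent step: the Bakry-Émery condition, integrated. -/
theorem integral_gamma_resolvent_le (hΓ : E.IsCarreDuChamp Γ) {K lam σ : ℝ}
    (hBE : E.BakryEmery Γ K ∞) (hK : -K ≤ lam) (hσ : 0 < σ) (hθ : 0 < 1 - 2 * lam * σ)
    (w : E.domain) {φ : Lp ℝ 2 m} {M : ℝ} (hM : 0 ≤ M) (hφ : ∀ᵐ x ∂m, |φ x| ≤ M)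
    (hφ0 : ∀ᵐ x ∂m, 0 ≤ φ x) :
    ∫ x, Γ (E.resolvent σ w) (E.resolvent σ w) x * φ x ∂m
      ≤ ∫ x, Γ w w x * (E.shiftedResolvent σ (1 - 2 * lam * σ) φ : Lp ℝ 2 m) x ∂m := by
  set θ := 1 - 2 * lam * σ with hθdef
  set u := E.resolvent σ w with hu
  set φ' := E.shiftedResolvent σ θ φ with hφ'
  set L : E.domain := σ⁻¹ • (u - w) with hL
  set Lφ : Lp ℝ 2 m := σ⁻¹ • (θ • (φ' : Lp ℝ 2 m) - φ) with hLφ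
  have hb' : ∀ᵐ x ∂m, |(φ' : Lp ℝ 2 m) x| ≤ θ⁻¹ * M := E.abs_shiftedResolvent_le hσ hθ hM hφ
  have hbL := abs_laplacian_shiftedResolvent_le (θ := θ) hσ hb' hφ
  have h0' : ∀ᵐ x ∂m, 0 ≤ (φ' : Lp ℝ 2 m) x := E.shiftedResolvent_nonneg hσ hθ hφ0
  have hBE' := hBE u L φ' Lφ (E.hasLaplacian_resolvent hσ w)
    (E.hasLaplacian_shiftedResolvent hσ hθ φ) (memLp_top_of_abs_le hb')
    (memLp_top_of_abs_le hbL) h0'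
  simp only [ENNReal.inv_top, ENNReal.toReal_zero, zero_mul, add_zero, Gamma2] at hBE'
  have hw : w = u + (-σ) • L := by
    rw [hL, smul_smul, neg_mul, mul_inv_cancel₀ hσ.ne', neg_one_smul]
    abel
  have i1 := integrable_mul_of_bounded (integrable_gamma (Γ := Γ) u u) φ' hb'
  have i2 := integrable_mul_of_bounded (integrable_gamma (Γ := Γ) u L) φ' hb'
  have i3 := integrable_mul_of_bounded (integrable_gamma (Γ := Γ) L L) φ' hb'
  have i4 := integrable_mul_of_bounded (integrable_gamma (Γ := Γ) u u) Lφ hbL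
  have e1 : ∫ x, Γ w w x * (φ' : Lp ℝ 2 m) x ∂m
      = ∫ x, Γ u u x * (φ' : Lp ℝ 2 m) x ∂m - 2 * σ * ∫ x, Γ u L x * (φ' : Lp ℝ 2 m) x ∂m
        + σ ^ 2 * ∫ x, Γ L L x * (φ' : Lp ℝ 2 m) x ∂m := by
    rw [← integral_sub_mul_add_mul i1 i2 i3]
    refine integral_congr_ae ?_
    have h := hΓ.gamma_add_smul u L (-σ)
    rw [← hw] at h
    filter_upwards [h] with x hx
    rw [hx]
    ring
  have e2 : ∫ x, ((1 / 2) * Γ u u x * Lφ x - Γ u L x * (φ' : Lp ℝ 2 m) x) ∂m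
      = (1 / 2) * ∫ x, Γ u u x * Lφ x ∂m - ∫ x, Γ u L x * (φ' : Lp ℝ 2 m) x ∂m := by
    rw [← integral_const_mul, ← integral_sub (i4.const_mul _) i2]
    simp only [mul_assoc]
  have e3 : ∫ x, Γ u u x * φ x ∂m
      = θ * ∫ x, Γ u u x * (φ' : Lp ℝ 2 m) x ∂m - σ * ∫ x, Γ u u x * Lφ x ∂m := by
    rw [← integral_const_mul, ← integral_const_mul, ← integral_sub (i1.const_mul _)
      (i4.const_mul _)]
    refine integral_congr_ae ?_
    filter_upwards [coeFn_laplacian_shiftedResolvent (θ := θ) hσ (φ' : Lp ℝ 2 m) φ] with x hx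
    rw [hx]
    ring
  have p1 : 0 ≤ ∫ x, Γ u u x * (φ' : Lp ℝ 2 m) x ∂m := integral_nonneg_of_ae (by
    filter_upwards [hΓ.nonneg u, h0'] with x h1 h2 using mul_nonneg h1 h2)
  have p2 : 0 ≤ ∫ x, Γ L L x * (φ' : Lp ℝ 2 m) x ∂m := integral_nonneg_of_ae (by
    filter_upwards [hΓ.nonneg L, h0'] with x h1 h2 using mul_nonneg h1 h2)
  -- by the equations of `u` and `φ'`, the difference of the two sides is `2 σ` times the
  -- Bakry-Émery inequality, plus `2 σ (λ + K) ∫ Γ(u) φ'` and `σ² ∫ Γ(Δ u) φ'`, both nonnegative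
  rw [e2] at hBE'
  rw [e1, e3, hθdef]
  have p3 := mul_le_mul_of_nonneg_left hBE' hσ.le
  have p4 := mul_nonneg (mul_nonneg hσ.le p1) (by linarith : 0 ≤ lam + K)
  nlinarith [mul_nonneg (sq_nonneg σ) p2]

/-- The energy gained by one resolvent step. -/
theorem integral_gamma_resolvent_add_le (hΓ : E.IsCarreDuChamp Γ) {lam σ : ℝ} (hlam : 0 ≤ lam)
    (hσ : 0 < σ) (hθ : 0 < 1 - 2 * lam * σ) {w φ : Lp ℝ 2 m} {M N : ℝ} (hM : 0 < M) (hN : 0 < N)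
    (hw : ∀ᵐ x ∂m, |w x| ≤ N) (hφ : ∀ᵐ x ∂m, |φ x| ≤ M) (hφ0 : ∀ᵐ x ∂m, 0 ≤ φ x) :
    2 * σ * ∫ x, Γ (E.resolvent σ w) (E.resolvent σ w) x
        * (E.shiftedResolvent σ (1 - 2 * lam * σ) φ : Lp ℝ 2 m) x ∂m
      + ∫ x, (E.resolvent σ w : Lp ℝ 2 m) x * (E.resolvent σ w : Lp ℝ 2 m) x * φ x ∂m
      ≤ ∫ x, w x * w x * (E.shiftedResolvent σ (1 - 2 * lam * σ) φ : Lp ℝ 2 m) x ∂m := by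
  set θ := 1 - 2 * lam * σ with hθdef
  set u := E.resolvent σ w with hu
  set φ' := E.shiftedResolvent σ θ φ with hφ'
  set L : Lp ℝ 2 m := σ⁻¹ • ((u : Lp ℝ 2 m) - w) with hL
  set Lφ : Lp ℝ 2 m := σ⁻¹ • (θ • (φ' : Lp ℝ 2 m) - φ) with hLφ
  have hΔu : E.HasLaplacian u L := E.hasLaplacian_resolvent hσ w
  have hΔφ : E.HasLaplacian φ' Lφ := E.hasLaplacian_shiftedResolvent hσ hθ φ
  have hbu : ∀ᵐ x ∂m, |(u : Lp ℝ 2 m) x| ≤ N := E.abs_resolvent_le hσ hN.le hw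
  have hb' : ∀ᵐ x ∂m, |(φ' : Lp ℝ 2 m) x| ≤ θ⁻¹ * M := E.abs_shiftedResolvent_le hσ hθ hM.le hφ
  have hbL := abs_laplacian_shiftedResolvent_le (θ := θ) hσ hb' hφ
  have h0' : ∀ᵐ x ∂m, 0 ≤ (φ' : Lp ℝ 2 m) x := E.shiftedResolvent_nonneg hσ hθ hφ0
  obtain ⟨uu, huu⟩ := E.exists_sq_mem hN hbu
  obtain ⟨uφ, huφ⟩ := E.exists_mul_mem hN (mul_pos (inv_pos.2 hθ) hM) hbu hb'
  have hrep := hΓ.representation u φ' uu uφ (memLp_top_of_abs_le hbu) (memLp_top_of_abs_le hb')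
    huu huφ
  have i1 := integrable_mul_of_bounded (integrable_mul (u : Lp ℝ 2 m) u) φ' hb'
  have i2 := integrable_mul_of_bounded (integrable_mul L (u : Lp ℝ 2 m)) φ' hb'
  have i3 := integrable_mul_of_bounded (integrable_mul L L) φ' hb'
  have i4 := integrable_mul_of_bounded (integrable_mul (u : Lp ℝ 2 m) u) Lφ hbL
  have e1 : E.form u uφ = -∫ x, L x * (u : Lp ℝ 2 m) x * (φ' : Lp ℝ 2 m) x ∂m := by
    have h1 := (E.hasLaplacian_iff.1 hΔu) uφ
    rw [inner_eq_integral_mul] at h1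
    rw [← neg_eq_iff_eq_neg, h1]
    refine integral_congr_ae ?_
    filter_upwards [huφ] with x hx
    rw [hx, mul_assoc]
  have e2 : E.form uu φ' = -∫ x, (u : Lp ℝ 2 m) x * (u : Lp ℝ 2 m) x * Lφ x ∂m := by
    have h1 := (E.hasLaplacian_iff.1 hΔφ) uu
    rw [inner_eq_integral_mul] at h1
    rw [E.symm, ← neg_eq_iff_eq_neg, h1]
    refine integral_congr_ae ?_
    filter_upwards [huu] with x hx
    rw [hx, mul_comm]
  have e3 : ∫ x, w x * w x * (φ' : Lp ℝ 2 m) x ∂m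
      = ∫ x, (u : Lp ℝ 2 m) x * (u : Lp ℝ 2 m) x * (φ' : Lp ℝ 2 m) x ∂m
        - 2 * σ * ∫ x, L x * (u : Lp ℝ 2 m) x * (φ' : Lp ℝ 2 m) x ∂m
        + σ ^ 2 * ∫ x, L x * L x * (φ' : Lp ℝ 2 m) x ∂m := by
    rw [← integral_sub_mul_add_mul i1 i2 i3]
    refine integral_congr_ae ?_
    filter_upwards [coeFn_smul_sub (u : Lp ℝ 2 m) w σ⁻¹] with x hx
    have h1 : w x = (u : Lp ℝ 2 m) x - σ * L x := by
      rw [hL, hx, mul_inv_cancel_left₀ hσ.ne']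
      ring
    rw [h1]
    ring
  have e4 : ∫ x, (u : Lp ℝ 2 m) x * (u : Lp ℝ 2 m) x * φ x ∂m
      = θ * ∫ x, (u : Lp ℝ 2 m) x * (u : Lp ℝ 2 m) x * (φ' : Lp ℝ 2 m) x ∂m
        - σ * ∫ x, (u : Lp ℝ 2 m) x * (u : Lp ℝ 2 m) x * Lφ x ∂m := by
    rw [← integral_const_mul, ← integral_const_mul, ← integral_sub (i1.const_mul _)
      (i4.const_mul _)]
    refine integral_congr_ae ?_
    filter_upwards [coeFn_laplacian_shiftedResolvent (θ := θ) hσ (φ' : Lp ℝ 2 m) φ] with x hx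
    rw [hx]
    ring
  have p1 : 0 ≤ ∫ x, (u : Lp ℝ 2 m) x * (u : Lp ℝ 2 m) x * (φ' : Lp ℝ 2 m) x ∂m :=
    integral_nonneg_of_ae (by
      filter_upwards [h0'] with x h2 using mul_nonneg (mul_self_nonneg _) h2)
  have p2 : 0 ≤ ∫ x, L x * L x * (φ' : Lp ℝ 2 m) x ∂m :=
    integral_nonneg_of_ae (by
      filter_upwards [h0'] with x h2 using mul_nonneg (mul_self_nonneg _) h2)
  -- the difference of the two sides is `2 λ σ ∫ u² φ' + σ² ∫ (Δ u)² φ'`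
  rw [hrep, e1, e2, e3, e4, hθdef]
  nlinarith [mul_nonneg (sq_nonneg σ) p2, mul_nonneg (mul_nonneg hlam hσ.le) p1]

/-- The iterated resolvent `(1 - σ Δ)^(-(n + 1))`, with values in the domain. -/
noncomputable def resolventIter (E : DirichletForm m) (σ : ℝ) : ℕ → Lp ℝ 2 m →ₗ[ℝ] E.domain
  | 0 => E.resolvent σ
  | n + 1 => E.resolvent σ ∘ₗ E.domain.subtype ∘ₗ resolventIter E σ n

theorem resolventIter_zero (σ : ℝ) (g : Lp ℝ 2 m) :
    E.resolventIter σ 0 g = E.resolvent σ g := rfl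

theorem resolventIter_succ (σ : ℝ) (n : ℕ) (g : Lp ℝ 2 m) :
    E.resolventIter σ (n + 1) g = E.resolvent σ (E.resolventIter σ n g : Lp ℝ 2 m) := rfl

theorem resolventIter_succ' (σ : ℝ) (n : ℕ) (g : Lp ℝ 2 m) :
    E.resolventIter σ (n + 1) g = E.resolventIter σ n (E.resolvent σ g : Lp ℝ 2 m) := by
  induction n with
  | zero => rfl
  | succ n ih => rw [resolventIter_succ, ih, resolventIter_succ]

theorem abs_resolventIter_le {σ : ℝ} (hσ : 0 < σ) {g : Lp ℝ 2 m} {N : ℝ} (hN : 0 ≤ N)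
    (hg : ∀ᵐ x ∂m, |g x| ≤ N) (n : ℕ) :
    ∀ᵐ x ∂m, |(E.resolventIter σ n g : Lp ℝ 2 m) x| ≤ N := by
  induction n with
  | zero => exact E.abs_resolvent_le hσ hN hg
  | succ n ih => exact E.abs_resolvent_le hσ hN ih

theorem integral_mul_indicatorConstLp {s : Set X} (hs : MeasurableSet s) (hms : m s ≠ ∞)
    (F : X → ℝ) : ∫ x, F x * indicatorConstLp 2 hs hms (1 : ℝ) x ∂m = ∫ x in s, F x ∂m := by
  rw [← integral_indicator hs]
  refine integral_congr_ae ?_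
  filter_upwards [indicatorConstLp_coeFn (p := 2) (hs := hs) (hμs := hms) (c := (1 : ℝ))] with x hx
  rw [hx]
  by_cases h : x ∈ s <;> simp [h]

/-- The energy gained in `n + 1` resolvent steps, tested against `φ`. The right-hand side is
`∫ g² Tⁿ⁺¹ φ` with the shifted resolvent `T`, written by symmetry as `∫ (Tⁿ⁺¹ g²) φ`. -/
theorem integral_gamma_resolventIter_add_le (hΓ : E.IsCarreDuChamp Γ) {K lam σ : ℝ}
    (hBE : E.BakryEmery Γ K ∞) (hK : -K ≤ lam) (hlam : 0 ≤ lam) (hσ : 0 < σ)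
    (hθ : 0 < 1 - 2 * lam * σ) {g gg : Lp ℝ 2 m} {N : ℝ} (hN : 0 < N) (hg : ∀ᵐ x ∂m, |g x| ≤ N)
    (hgg : ∀ᵐ x ∂m, gg x = g x * g x) (n : ℕ) {φ : Lp ℝ 2 m} {M : ℝ} (hM : 0 < M)
    (hφ : ∀ᵐ x ∂m, |φ x| ≤ M) (hφ0 : ∀ᵐ x ∂m, 0 ≤ φ x) :
    2 * σ * (n + 1) *
        ∫ x, Γ (E.resolventIter σ (n + 1) g) (E.resolventIter σ (n + 1) g) x * φ x ∂m
      + ∫ x, (E.resolventIter σ n g : Lp ℝ 2 m) x * (E.resolventIter σ n g : Lp ℝ 2 m) x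
          * φ x ∂m
      ≤ inner ℝ
          ((fun ψ : Lp ℝ 2 m => (E.shiftedResolvent σ (1 - 2 * lam * σ) ψ : Lp ℝ 2 m))^[n + 1] gg)
          φ := by
  induction n generalizing φ M with
  | zero =>
    have hB := integral_gamma_resolvent_le hΓ hBE hK hσ hθ (E.resolvent σ g) hM.le hφ hφ0
    have hA := integral_gamma_resolvent_add_le hΓ hlam hσ hθ hM hN hg hφ hφ0
    have e : ∫ x, g x * g x * (E.shiftedResolvent σ (1 - 2 * lam * σ) φ : Lp ℝ 2 m) x ∂m
        = inner ℝ (E.shiftedResolvent σ (1 - 2 * lam * σ) gg : Lp ℝ 2 m) φ := by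
      rw [E.inner_shiftedResolvent_left hσ hθ, inner_eq_integral_mul]
      refine integral_congr_ae ?_
      filter_upwards [hgg] with x hx
      rw [hx]
    rw [e] at hA
    simp only [Nat.cast_zero, zero_add, mul_one, Function.iterate_one, resolventIter_succ,
      resolventIter_zero]
    have := mul_le_mul_of_nonneg_left hB (by positivity : 0 ≤ 2 * σ)
    linarith
  | succ n ih =>
    have hB := integral_gamma_resolvent_le hΓ hBE hK hσ hθ (E.resolventIter σ (n + 1) g) hM.le
      hφ hφ0
    have hA := integral_gamma_resolvent_add_le hΓ hlam hσ hθ hM hN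
      (abs_resolventIter_le (E := E) hσ hN.le hg n) hφ hφ0
    have hI := ih (mul_pos (inv_pos.2 hθ) hM) (E.abs_shiftedResolvent_le hσ hθ hM.le hφ)
      (E.shiftedResolvent_nonneg hσ hθ hφ0)
    rw [← E.inner_shiftedResolvent_left hσ hθ] at hI
    rw [Function.iterate_succ_apply' _ (n + 1)]
    rw [← resolventIter_succ] at hA hB
    push_cast
    have := mul_le_mul_of_nonneg_left hB (by positivity : 0 ≤ 2 * σ * (n + 1 + 1))
    linarith

/-- The reverse Poincaré inequality: a pointwise gradient bound for iterated resolvents of bounded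
functions. -/
theorem gamma_resolventIter_le [SigmaFinite m] (hΓ : E.IsCarreDuChamp Γ) {K lam σ : ℝ}
    (hBE : E.BakryEmery Γ K ∞) (hK : -K ≤ lam) (hlam : 0 ≤ lam) (hσ : 0 < σ)
    (hθ : 0 < 1 - 2 * lam * σ) {g : Lp ℝ 2 m} {N : ℝ} (hN : 0 < N) (hg : ∀ᵐ x ∂m, |g x| ≤ N)
    (n : ℕ) :
    ∀ᵐ x ∂m, Γ (E.resolventIter σ (n + 1) g) (E.resolventIter σ (n + 1) g) x
      ≤ N ^ 2 / (2 * σ * (n + 1) * (1 - 2 * lam * σ) ^ (n + 1)) := by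
  set θ := 1 - 2 * lam * σ with hθdef
  have hggm : MemLp (fun x => g x * g x) 2 m := by
    refine (Lp.memLp g).of_le_mul (c := N) ((Lp.memLp g).1.mul (Lp.memLp g).1) ?_
    filter_upwards [hg] with x hx
    rw [norm_mul]
    exact mul_le_mul_of_nonneg_right hx (norm_nonneg _)
  set gg : Lp ℝ 2 m := hggm.toLp with hggdef
  have hgg : ∀ᵐ x ∂m, gg x = g x * g x := hggm.coeFn_toLp
  have hTb : ∀ k : ℕ, ∀ᵐ x ∂m,
      |(fun ψ : Lp ℝ 2 m => (E.shiftedResolvent σ θ ψ : Lp ℝ 2 m))^[k] gg x|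
        ≤ N ^ 2 / θ ^ k := by
    intro k
    induction k with
    | zero =>
      filter_upwards [hgg, hg] with x h1 h2
      rw [Function.iterate_zero, id, h1, abs_mul, pow_zero, div_one, sq]
      exact mul_le_mul h2 h2 (abs_nonneg _) hN.le
    | succ k ih =>
      rw [Function.iterate_succ_apply']
      filter_upwards [E.abs_shiftedResolvent_le hσ hθ (by positivity) ih] with x hx
      refine hx.trans_eq ?_
      rw [pow_succ θ, ← div_div, inv_mul_eq_div]
  set P := 2 * σ * (n + 1) with hP
  have hPpos : 0 < P := by positivity
  set u := E.resolventIter σ (n + 1) g with hu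
  suffices h : 0 ≤ᵐ[m] fun x => N ^ 2 / (P * θ ^ (n + 1)) - Γ u u x by
    filter_upwards [h] with x hx
    exact sub_nonneg.1 hx
  refine ae_nonneg_of_forall_setIntegral_nonneg_of_sigmaFinite
    (fun s _ hs => (integrableOn_const hs.ne).sub (integrable_gamma u u).integrableOn) ?_
  intro s hs hms
  have hc : ∀ c : ℝ, Integrable (fun _ => c) (m.restrict s) :=
    fun c => integrableOn_const hms.ne
  rw [integral_sub (hc _) (integrable_gamma u u).integrableOn, sub_nonneg,
    setIntegral_const, smul_eq_mul]
  have hco := indicatorConstLp_coeFn (p := 2) (hs := hs) (hμs := hms.ne) (c := (1 : ℝ))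
  have hmain := integral_gamma_resolventIter_add_le hΓ hBE hK hlam hσ hθ hN hg hgg n
    (φ := indicatorConstLp 2 hs hms.ne 1) one_pos (by
      filter_upwards [hco] with x hx
      rw [hx]
      by_cases h : x ∈ s <;> simp [h]) (by
      filter_upwards [hco] with x hx
      rw [hx]
      by_cases h : x ∈ s <;> simp [h])
  rw [inner_eq_integral_mul, integral_mul_indicatorConstLp, integral_mul_indicatorConstLp,
    integral_mul_indicatorConstLp] at hmain
  -- the term `∫ (Sⁿ⁺¹ g)² φ` is dropped
  have h1 : 0 ≤ ∫ x in s, (E.resolventIter σ n g : Lp ℝ 2 m) x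
      * (E.resolventIter σ n g : Lp ℝ 2 m) x ∂m :=
    integral_nonneg fun x => mul_self_nonneg _
  have h2 : ∫ x in s, (fun ψ : Lp ℝ 2 m => (E.shiftedResolvent σ θ ψ : Lp ℝ 2 m))^[n + 1] gg x ∂m
      ≤ m.real s * (N ^ 2 / θ ^ (n + 1)) := by
    rw [← smul_eq_mul, ← setIntegral_const]
    refine integral_mono_ae ?_ (hc _) (ae_restrict_of_ae ?_)
    · exact integrableOn_Lp_of_measure_ne_top _ one_le_two hms.ne
    · filter_upwards [hTb (n + 1)] with x hx using (le_abs_self _).trans hx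
  have h3 : P * ∫ x in s, Γ u u x ∂m ≤ m.real s * (N ^ 2 / θ ^ (n + 1)) := by linarith
  rw [mul_comm P, ← le_div_iff₀ hPpos] at h3
  refine h3.trans_eq ?_
  field_simp

/-! ### The interpolation estimate for `Δ f ∈ L² ∩ L^∞` -/

theorem form_smul_self (u : E.domain) (t : ℝ) : E.form (t • u) (t • u) = t ^ 2 * E.form u u := by
  rw [map_smul, map_smul, LinearMap.smul_apply, smul_eq_mul, smul_eq_mul]
  ring

theorem mul_form_resolvent_le {σ : ℝ} (hσ : 0 < σ) (g : Lp ℝ 2 m) :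
    σ * E.form (E.resolvent σ g) (E.resolvent σ g) ≤ ‖g‖ ^ 2 := by
  have h1 := E.resolvent_spec hσ g (E.resolvent σ g)
  rw [real_inner_self_eq_norm_sq] at h1
  have h2 := real_inner_le_norm g (E.resolvent σ g : Lp ℝ 2 m)
  nlinarith [sq_nonneg (‖g‖ - ‖(E.resolvent σ g : Lp ℝ 2 m)‖), sq_nonneg ‖g‖]

theorem gamma_smul_le {u : E.domain} {t b c : ℝ} (hu : ∀ᵐ x ∂m, Γ u u x ≤ b)
    (h : t ^ 2 * b ≤ c) : ∀ᵐ x ∂m, Γ (t • u) (t • u) x ≤ c := by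
  filter_upwards [gamma_smul (Γ := Γ) u t, hu] with x h1 h2
  rw [h1]
  exact (mul_le_mul_of_nonneg_left h2 (sq_nonneg t)).trans h

/-- Interpolation at the discrete time `n + 1`, with step `σ`: the function `f + σ S g`, where
`S = (1 - σ Δ)⁻¹` and `g = Δ f - λ f`, is the sum of the multiple `(1 - λ σ)ⁿ⁺² Sⁿ⁺² f` and of
`-σ ∑ j ≤ n, (1 - λ σ)ʲ⁺¹ Sʲ⁺² g`; the reverse Poincaré inequality bounds the gradient of each
term. -/
theorem gamma_add_smul_resolvent_le [SigmaFinite m] (hΓ : E.IsCarreDuChamp Γ) {K lam σ : ℝ}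
    (hBE : E.BakryEmery Γ K ∞) (hK : -K ≤ lam) (hlam : 0 ≤ lam) (hσ : 0 < σ)
    (hθ : 0 < 1 - 2 * lam * σ) {f : E.domain} {L : Lp ℝ 2 m} (hfL : E.HasLaplacian f L)
    {F G : ℝ} (hF : 0 < F) (hG : 0 < G) (hf : ∀ᵐ x ∂m, |(f : Lp ℝ 2 m) x| ≤ F)
    (hg : ∀ᵐ x ∂m, |(L - lam • (f : Lp ℝ 2 m) : Lp ℝ 2 m) x| ≤ G) (n : ℕ) :
    ∀ᵐ x ∂m, Γ (f + σ • E.resolvent σ (L - lam • (f : Lp ℝ 2 m)))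
        (f + σ • E.resolvent σ (L - lam • (f : Lp ℝ 2 m))) x
      ≤ ((1 - lam * σ) ^ 2 / (1 - 2 * lam * σ)) ^ (n + 1)
        * (F / √(2 * σ * (n + 1)) + G * √(2 * σ * (n + 1))) ^ 2 := by
  set θ := 1 - 2 * lam * σ with hθdef
  set r := 1 - lam * σ with hr
  set g := L - lam • (f : Lp ℝ 2 m) with hgdef
  set u : ℕ → E.domain := fun n => E.resolventIter σ n f with hu
  set v : ℕ → E.domain := fun n => E.resolventIter σ n g with hv
  have hlσ : 0 ≤ lam * σ := mul_nonneg hlam hσ.le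
  have hr0 : 0 < r := by rw [hr]; rw [hθdef] at hθ; linarith
  have hr1 : r ≤ 1 := by rw [hr]; linarith
  set q := r / √θ with hq
  have hsθ : 0 < √θ := Real.sqrt_pos.2 hθ
  have hq0 : 0 < q := div_pos hr0 hsθ
  have hq2 : q ^ 2 = r ^ 2 / θ := by rw [hq, div_pow, Real.sq_sqrt hθ.le]
  have hq1 : 1 ≤ q := by
    rw [hq, one_le_div hsθ, Real.sqrt_le_left hr0.le, hr, hθdef]
    nlinarith [sq_nonneg (lam * σ)]
  have hrθ : ∀ k : ℕ, r ^ (2 * k) / θ ^ k = (q ^ k) ^ 2 := by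
    intro k
    rw [← pow_mul, mul_comm k 2, pow_mul, pow_mul, hq2, div_pow]
  have hstep : f = r • E.resolvent σ f - σ • E.resolvent σ g := by
    rw [← map_smul, ← map_smul, ← map_sub]
    refine (E.resolvent_unique hσ hfL ?_).symm
    rw [hgdef, hr]
    module
  have hiter : ∀ k, u k = r • u (k + 1) - σ • v (k + 1) := by
    intro k
    have h := congrArg (fun w : E.domain => E.resolventIter σ k (w : Lp ℝ 2 m)) hstep
    simp only [Submodule.coe_sub, Submodule.coe_smul, map_sub, map_smul] at h
    simp only [hu, hv, resolventIter_succ']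
    exact h
  -- the bound `∑ 1 ≤ j ≤ k, σ G qʲ / √(2 σ j)` on `√Γ` is at most `qᵏ G √(2 σ k)`
  have hD : ∀ k : ℕ, ∀ᵐ x ∂m, Γ (f + σ • E.resolvent σ g - r ^ (k + 1) • u k)
      (f + σ • E.resolvent σ g - r ^ (k + 1) • u k) x ≤ (q ^ k * G * √(2 * σ * k)) ^ 2 := by
    intro k
    induction k with
    | zero =>
      have h0 : f + σ • E.resolvent σ g - r ^ (0 + 1) • u 0 = 0 := by
        have h1 : u 0 = E.resolvent σ f := rfl
        rw [zero_add, pow_one, h1]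
        nth_rewrite 1 [hstep]
        abel
      rw [h0, map_zero]
      filter_upwards [Lp.coeFn_zero ℝ 1 m] with x hx
      rw [hx]
      simp
    | succ k ih =>
      have hdec : f + σ • E.resolvent σ g - r ^ (k + 1 + 1) • u (k + 1)
          = (f + σ • E.resolvent σ g - r ^ (k + 1) • u k) + (-(r ^ (k + 1) * σ)) • v (k + 1) := by
        rw [hiter k]
        module
      rw [hdec]
      set y := √(2 * σ * ((k + 1 : ℕ) : ℝ)) with hy
      set z := √(2 * σ * (k : ℝ)) with hz
      have hy2 : y ^ 2 = 2 * σ * (k + 1) := by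
        rw [hy, Real.sq_sqrt (by positivity)]
        push_cast
        ring
      have hz2 : z ^ 2 = 2 * σ * k := Real.sq_sqrt (by positivity)
      have hy0 : 0 < y := Real.sqrt_pos.2 (by positivity)
      have hz0 : 0 ≤ z := Real.sqrt_nonneg _
      have hv1 := gamma_resolventIter_le hΓ hBE hK hlam hσ hθ hG hg k
      have hv2 : ∀ᵐ x ∂m, Γ ((-(r ^ (k + 1) * σ)) • v (k + 1)) ((-(r ^ (k + 1) * σ)) • v (k + 1)) x
          ≤ (q ^ (k + 1) * G * (σ / y)) ^ 2 := by
        refine gamma_smul_le hv1 (le_of_eq ?_)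
        rw [← hθdef, mul_pow, mul_pow, ← hrθ (k + 1), div_pow, hy2]
        field_simp
        ring
      have h3 := hΓ.gamma_add_le_sq (by positivity) (by positivity) ih hv2
      filter_upwards [h3] with x hx
      refine hx.trans (pow_le_pow_left₀ (by positivity) ?_ 2)
      have h4 : z + σ / y ≤ y := by
        rw [← le_sub_iff_add_le', div_le_iff₀ hy0]
        nlinarith [sq_nonneg (y - z)]
      have h5 : q ^ k ≤ q ^ (k + 1) := pow_le_pow_right₀ hq1 (Nat.le_succ k)
      calc q ^ k * G * z + q ^ (k + 1) * G * (σ / y)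
          ≤ q ^ (k + 1) * G * z + q ^ (k + 1) * G * (σ / y) := by gcongr
        _ = q ^ (k + 1) * G * (z + σ / y) := by ring
        _ ≤ q ^ (k + 1) * G * y := by gcongr
  have hdec : f + σ • E.resolvent σ g
      = (f + σ • E.resolvent σ g - r ^ (n + 1 + 1) • u (n + 1)) + r ^ (n + 1 + 1) • u (n + 1) := by
    abel
  rw [hdec]
  set y := √(2 * σ * ((n : ℝ) + 1)) with hy
  have hy2 : y ^ 2 = 2 * σ * (n + 1) := Real.sq_sqrt (by positivity)
  have hy0 : 0 < y := Real.sqrt_pos.2 (by positivity)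
  have h1 := gamma_resolventIter_le hΓ hBE hK hlam hσ hθ hF hf n
  have h2 : ∀ᵐ x ∂m, Γ (r ^ (n + 1 + 1) • u (n + 1)) (r ^ (n + 1 + 1) • u (n + 1)) x
      ≤ (q ^ (n + 1) * (F / y)) ^ 2 := by
    refine gamma_smul_le h1 ?_
    rw [← hθdef, mul_pow, ← hrθ (n + 1), div_pow, hy2, ← pow_mul]
    have h3 : r ^ ((n + 1 + 1) * 2) ≤ r ^ (2 * (n + 1)) :=
      pow_le_pow_of_le_one hr0.le hr1 (by omega)
    calc r ^ ((n + 1 + 1) * 2) * (F ^ 2 / (2 * σ * (n + 1) * θ ^ (n + 1)))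
        ≤ r ^ (2 * (n + 1)) * (F ^ 2 / (2 * σ * (n + 1) * θ ^ (n + 1))) := by gcongr
      _ = _ := by field_simp
  have h4 := hΓ.gamma_add_le_sq (by positivity) (by positivity) (hD (n + 1)) h2
  filter_upwards [h4] with x hx
  refine hx.trans_eq ?_
  have h5 : √(2 * σ * ((n + 1 : ℕ) : ℝ)) = y := by rw [hy, Nat.cast_add_one]
  rw [h5, ← hq2, ← pow_mul, mul_comm 2, pow_mul]
  ring

/-- The interpolation estimate for functions with Laplacian in `L² ∩ L^∞`, with constant `4`: the
limit of vanishing step size at the time `t = F / (2 G)`. -/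
theorem gamma_le_four_mul [SigmaFinite m] (hΓ : E.IsCarreDuChamp Γ) {K lam : ℝ}
    (hBE : E.BakryEmery Γ K ∞) (hK : -K ≤ lam) (hlam : 0 ≤ lam)
    {f : E.domain} {L : Lp ℝ 2 m} (hfL : E.HasLaplacian f L)
    {F G : ℝ} (hF : 0 < F) (hG : 0 < G) (hf : ∀ᵐ x ∂m, |(f : Lp ℝ 2 m) x| ≤ F)
    (hg : ∀ᵐ x ∂m, |L x - lam * (f : Lp ℝ 2 m) x| ≤ G) :
    ∀ᵐ x ∂m, Γ f f x ≤ 4 * F * G := by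
  set t := F / (2 * G) with ht
  have ht0 : 0 < t := by positivity
  set g := L - lam • (f : Lp ℝ 2 m) with hgdef
  have hg' : ∀ᵐ x ∂m, |g x| ≤ G := by
    filter_upwards [hg, coeFn_sub_smul L (f : Lp ℝ 2 m) lam] with x h1 h2
    rwa [hgdef, h2]
  set σ : ℕ → ℝ := fun n => t / (n + 1) with hσdef
  have hσ : ∀ n, 0 < σ n := fun n => by positivity
  have hσlim : Tendsto σ atTop (𝓝 0) := by
    have := tendsto_one_div_add_atTop_nhds_zero_nat (𝕜 := ℝ) |>.const_mul t
    rw [mul_zero] at this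
    refine this.congr fun n => ?_
    rw [hσdef, mul_one_div]
  have hsmall : ∀ᶠ n in atTop, 2 * lam * σ n < 1 / 2 := by
    have := hσlim.const_mul (2 * lam)
    rw [mul_zero] at this
    exact this.eventually_lt_const (by norm_num)
  -- `(1 - λ σ)² / (1 - 2 λ σ) ≤ exp (2 λ² σ²)`, and `σ n * (n + 1) = t`
  refine hΓ.gamma_le_of_tendsto (u := fun n => f + σ n • E.resolvent (σ n) g)
    (B := fun n => Real.exp (2 * lam ^ 2 * t * σ n) * (4 * F * G)) ?_ ?_ ?_
  · have hlim : Tendsto (fun n => σ n * ‖g‖ ^ 2) atTop (𝓝 0) := by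
      simpa using hσlim.mul_const (‖g‖ ^ 2)
    refine squeeze_zero (fun n => E.nonneg _) (fun n => ?_) hlim
    rw [add_sub_cancel_left, form_smul_self, sq, mul_assoc]
    exact mul_le_mul_of_nonneg_left (mul_form_resolvent_le (hσ n) g) (hσ n).le
  · have hc : Continuous fun s : ℝ => Real.exp (2 * lam ^ 2 * t * s) * (4 * F * G) := by fun_prop
    simpa [Function.comp_def] using (hc.tendsto 0).comp hσlim
  · filter_upwards [hsmall] with n hn
    have hθ : 0 < 1 - 2 * lam * σ n := by linarith
    filter_upwards [gamma_add_smul_resolvent_le hΓ hBE hK hlam (hσ n) hθ hfL hF hG hf hg' n]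
      with x hx
    refine hx.trans ?_
    have hσn : σ n * (n + 1) = t := by rw [hσdef]; field_simp
    have e1 : 2 * σ n * (n + 1) = F / G := by
      rw [mul_assoc, hσn, ht]
      field_simp
    have e2 : (F / √(F / G) + G * √(F / G)) ^ 2 = 4 * F * G := by
      have h1 : 0 < √(F / G) := Real.sqrt_pos.2 (by positivity)
      have h2 : √(F / G) ^ 2 = F / G := Real.sq_sqrt (by positivity)
      have h3 : F / √(F / G) = G * √(F / G) := by
        rw [div_eq_iff h1.ne', mul_assoc, ← sq, h2]
        field_simp
      rw [h3, ← two_mul, mul_pow, mul_pow, h2]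
      field_simp
      ring
    rw [e1, e2]
    refine mul_le_mul_of_nonneg_right ?_ (by positivity)
    have h3 : (1 - lam * σ n) ^ 2 / (1 - 2 * lam * σ n) ≤ 1 + 2 * lam ^ 2 * σ n ^ 2 := by
      rw [div_le_iff₀ hθ]
      nlinarith [mul_nonneg (mul_nonneg (sq_nonneg lam) (sq_nonneg (σ n)))
        (by linarith : 0 ≤ 1 / 2 - 2 * lam * σ n)]
    calc ((1 - lam * σ n) ^ 2 / (1 - 2 * lam * σ n)) ^ (n + 1)
        ≤ (Real.exp (2 * lam ^ 2 * σ n ^ 2)) ^ (n + 1) := by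
          refine pow_le_pow_left₀ (by positivity) (h3.trans ?_) _
          rw [add_comm]
          exact Real.add_one_le_exp _
      _ = Real.exp (2 * lam ^ 2 * t * σ n) := by
          rw [← Real.exp_nat_mul, ← hσn]
          congr 1
          push_cast
          ring

/-! ### The estimate for bounded Laplacian -/

theorem form_add_self (u v : E.domain) :
    E.form (u + v) (u + v) = E.form u u + 2 * E.form u v + E.form v v := by
  simp only [map_add, LinearMap.add_apply, E.symm v u]
  ring

theorem two_mul_form_le (u v : E.domain) : 2 * E.form u v ≤ E.form u u + E.form v v := by
  have h := E.nonneg (u + (-1 : ℝ) • v)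
  rw [form_add_self, form_smul_self, map_smul, smul_eq_mul] at h
  linarith

/-- The equation of the resolvent, tested with `f - S f`. -/
theorem norm_sq_sub_resolvent_add {σ : ℝ} (hσ : 0 < σ) (f : E.domain) :
    ‖((f - E.resolvent σ f : E.domain) : Lp ℝ 2 m)‖ ^ 2
      + σ * E.form (f - E.resolvent σ f) (f - E.resolvent σ f)
      = σ * E.form f (f - E.resolvent σ f) := by
  set v := f - E.resolvent σ f with hv
  have h1 := E.resolvent_spec hσ f v
  have h2 : E.resolvent σ f = f - v := by rw [hv]; abel
  rw [h2, E.form.map_sub, LinearMap.sub_apply, Submodule.coe_sub, inner_sub_left,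
    real_inner_self_eq_norm_sq] at h1
  linarith

/-- Strong continuity of the resolvent in energy: `𝓔(v, v) ≤ 𝓔(f, v)` for `v = f - S f`, where
`f` may be replaced by an element of the domain of the generator, up to a small error. -/
theorem tendsto_form_sub_resolvent (f : E.domain) :
    Tendsto (fun n : ℕ => E.form (E.resolvent (1 / ((n : ℝ) + 1)) f - f)
      (E.resolvent (1 / ((n : ℝ) + 1)) f - f)) atTop (𝓝 0) := by
  set σ : ℕ → ℝ := fun n => 1 / ((n : ℝ) + 1) with hσdef
  have hσ : ∀ n, 0 < σ n := fun n => by positivity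
  have hσlim : Tendsto σ atTop (𝓝 0) := tendsto_one_div_add_atTop_nhds_zero_nat
  set v : ℕ → E.domain := fun n => f - E.resolvent (σ n) f with hv
  have hspec : ∀ n, ‖(v n : Lp ℝ 2 m)‖ ^ 2 + σ n * E.form (v n) (v n) = σ n * E.form f (v n) :=
    fun n => norm_sq_sub_resolvent_add (hσ n) f
  have h1 : ∀ n, E.form (v n) (v n) ≤ E.form f (v n) := fun n =>
    le_of_mul_le_mul_left (by linarith [hspec n, sq_nonneg ‖(v n : Lp ℝ 2 m)‖]) (hσ n)
  have h2 : ∀ n, E.form (v n) (v n) ≤ E.form f f := fun n => by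
    linarith [h1 n, two_mul_form_le f (v n)]
  have h3 : ∀ n, ‖(v n : Lp ℝ 2 m)‖ ^ 2 ≤ σ n * E.form f f := fun n => by
    have h4 : E.form f (v n) ≤ E.form f f := by linarith [h2 n, two_mul_form_le f (v n)]
    have h5 := mul_le_mul_of_nonneg_left h4 (hσ n).le
    linarith [hspec n, mul_nonneg (hσ n).le (E.nonneg (v n))]
  have hvlim : Tendsto (fun n => ‖(v n : Lp ℝ 2 m)‖) atTop (𝓝 0) := by
    have h4 : Tendsto (fun n => σ n * E.form f f) atTop (𝓝 0) := by
      simpa using hσlim.mul_const (E.form f f)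
    have h5 := (squeeze_zero (fun n => sq_nonneg _) h3 h4).sqrt
    simpa [Real.sqrt_sq (norm_nonneg _)] using h5
  have hvn : ∀ n, E.form (E.resolvent (σ n) f - f) (E.resolvent (σ n) f - f)
      = E.form (v n) (v n) := fun n => by
    have h4 : E.resolvent (σ n) f - f = (-1 : ℝ) • v n := by rw [hv]; module
    rw [h4, form_smul_self]
    ring
  refine Metric.tendsto_atTop.2 fun ε hε => ?_
  obtain ⟨k, hk⟩ := E.exists_resolvent_near one_pos f (ε := ε / 2) (by positivity)
  set w := E.resolvent 1 k with hw
  rw [one_mul] at hk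
  set C := ‖((w : Lp ℝ 2 m) - k)‖ with hC
  have hΔ := E.hasLaplacian_iff.1 (E.hasLaplacian_resolvent one_pos k)
  obtain ⟨N, hN⟩ := Metric.tendsto_atTop.1 (hvlim.const_mul C) (ε / 4) (by positivity)
  refine ⟨N, fun n hn => ?_⟩
  rw [hvn, Real.dist_0_eq_abs, abs_of_nonneg (E.nonneg _)]
  have h5 : C * ‖(v n : Lp ℝ 2 m)‖ < ε / 4 := by
    have := hN n hn
    rw [mul_zero, Real.dist_0_eq_abs] at this
    exact (le_abs_self _).trans_lt this
  have h6 : E.form w (v n) ≤ C * ‖(v n : Lp ℝ 2 m)‖ := by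
    have h7 := hΔ (v n)
    rw [inv_one, one_smul] at h7
    have h8 := abs_real_inner_le_norm ((w : Lp ℝ 2 m) - k) (v n : Lp ℝ 2 m)
    linarith [neg_abs_le (inner ℝ ((w : Lp ℝ 2 m) - k) (v n : Lp ℝ 2 m))]
  have h7 : E.form f (v n) = E.form (f - w) (v n) + E.form w (v n) := by
    rw [E.form.map_sub, LinearMap.sub_apply]
    ring
  have h8 := two_mul_form_le (f - w) (v n)
  have h9 := sq_nonneg ‖((f - w : E.domain) : Lp ℝ 2 m)‖
  have h10 := h1 n
  linarith

/-- The resolvent contracts the `L¹` norm of indicator functions; this is dual to its contraction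
of the `L^∞` norm. -/
theorem integrable_resolvent_indicator [SigmaFinite m] {σ : ℝ} (hσ : 0 < σ) {s : Set X}
    (hs : MeasurableSet s) (hms : m s ≠ ∞) :
    Integrable (E.resolvent σ (indicatorConstLp 2 hs hms 1) : Lp ℝ 2 m) m ∧
      ∫ x, (E.resolvent σ (indicatorConstLp 2 hs hms 1) : Lp ℝ 2 m) x ∂m ≤ m.real s := by
  have hco : ∀ {t : Set X} (ht : MeasurableSet t) (hmt : m t ≠ ∞),
      (∀ᵐ x ∂m, 0 ≤ indicatorConstLp 2 ht hmt (1 : ℝ) x) ∧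
        ∀ᵐ x ∂m, |indicatorConstLp 2 ht hmt (1 : ℝ) x| ≤ 1 := by
    intro t ht hmt
    constructor <;>
    · filter_upwards [indicatorConstLp_coeFn (p := 2) (hs := ht) (hμs := hmt) (c := (1 : ℝ))]
        with x hx
      rw [hx]
      by_cases h : x ∈ t <;> simp [h]
  set u := E.resolvent σ (indicatorConstLp 2 hs hms 1) with hu
  have hu0 : ∀ᵐ x ∂m, 0 ≤ (u : Lp ℝ 2 m) x := E.resolvent_nonneg hσ (hco hs hms).1
  have hbound : ∀ t, MeasurableSet t → m t ≠ ∞ →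
      ∫⁻ x in t, ‖(u : Lp ℝ 2 m) x‖ₑ ∂m ≤ ENNReal.ofReal (m.real s) := by
    intro t ht hmt
    have hint : IntegrableOn (u : Lp ℝ 2 m) t m :=
      integrableOn_Lp_of_measure_ne_top _ one_le_two hmt
    have h1 : ∫⁻ x in t, ‖(u : Lp ℝ 2 m) x‖ₑ ∂m
        = ENNReal.ofReal (∫ x in t, (u : Lp ℝ 2 m) x ∂m) := by
      rw [ofReal_integral_eq_lintegral_ofReal hint (ae_restrict_of_ae hu0)]
      refine lintegral_congr_ae (ae_restrict_of_ae ?_)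
      filter_upwards [hu0] with x hx
      exact Real.enorm_of_nonneg hx
    rw [h1]
    refine ENNReal.ofReal_le_ofReal ?_
    rw [← integral_mul_indicatorConstLp ht hmt, ← inner_eq_integral_mul, hu,
      E.inner_resolvent_left hσ, real_inner_comm, inner_eq_integral_mul,
      integral_mul_indicatorConstLp]
    have h2 : ∫ _ in s, (1 : ℝ) ∂m = m.real s := by simp
    rw [← h2]
    refine integral_mono_ae (integrableOn_Lp_of_measure_ne_top _ one_le_two hms)
      (integrableOn_const hms) (ae_restrict_of_ae ?_)
    filter_upwards [E.abs_resolvent_le hσ zero_le_one (hco ht hmt).2] with x hx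
      using (le_abs_self _).trans hx
  refine ⟨integrable_of_forall_fin_meas_le _ ENNReal.ofReal_lt_top (Lp.aestronglyMeasurable _)
    hbound, ?_⟩
  have h3 := lintegral_le_of_forall_fin_meas_le _ hbound
  rw [integral_eq_lintegral_of_nonneg_ae hu0 (Lp.aestronglyMeasurable _)]
  refine ENNReal.toReal_le_of_le_ofReal measureReal_nonneg (le_trans (le_of_eq ?_) h3)
  refine lintegral_congr_ae ?_
  filter_upwards [hu0] with x hx
  exact (Real.enorm_of_nonneg hx).symm

/-- The resolvent preserves bounds on `Δ f - λ f`. Here `Δ f` is bounded and possibly not in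
`L²`, and the bound follows by duality with indicator functions. -/
theorem abs_laplacian_resolvent_le [SigmaFinite m] {σ : ℝ} (hσ : 0 < σ) {f : E.domain}
    {h : X → ℝ} (hhm : AEStronglyMeasurable h m) {C : ℝ} (hhb : ∀ᵐ x ∂m, |h x| ≤ C)
    (hfh : E.HasLaplacian f h) {lam G : ℝ}
    (hg : ∀ᵐ x ∂m, |h x - lam * (f : Lp ℝ 2 m) x| ≤ G) :
    ∀ᵐ x ∂m, |(σ⁻¹ • ((E.resolvent σ f : Lp ℝ 2 m) - f) : Lp ℝ 2 m) x
      - lam * (E.resolvent σ f : Lp ℝ 2 m) x| ≤ G := by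
  rcases eq_or_ne m 0 with rfl | hm0
  · simp
  -- for `m = 0` the constant `G` may be negative
  have hG : 0 ≤ G := by
    have : NeZero m := ⟨hm0⟩
    obtain ⟨x, hx⟩ := hg.exists
    exact (abs_nonneg _).trans hx
  set W : Lp ℝ 2 m := σ⁻¹ • ((E.resolvent σ f : Lp ℝ 2 m) - f)
    - lam • (E.resolvent σ f : Lp ℝ 2 m) with hW
  have key : ∀ s, MeasurableSet s → m s < ∞ → |∫ x in s, W x ∂m| ≤ G * m.real s := by
    intro s hs hms
    set ψ : Lp ℝ 2 m := indicatorConstLp 2 hs hms.ne 1 with hψ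
    obtain ⟨hi, hle⟩ := integrable_resolvent_indicator (E := E) hσ hs hms.ne
    set v := E.resolvent σ ψ with hv
    have hv0 : ∀ᵐ x ∂m, 0 ≤ (v : Lp ℝ 2 m) x := E.resolvent_nonneg hσ (by
      filter_upwards [indicatorConstLp_coeFn (p := 2) (hs := hs) (hμs := hms.ne) (c := (1 : ℝ))]
        with x hx
      rw [hx]
      by_cases h : x ∈ s <;> simp [h])
    have hhv : Integrable (fun x => h x * (v : Lp ℝ 2 m) x) m := hi.bdd_mul hhm hhb
    have h1 : ∫ x in s, W x ∂m = inner ℝ W ψ := by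
      rw [inner_eq_integral_mul, integral_mul_indicatorConstLp]
    have h2 : inner ℝ W ψ
        = ∫ x, (h x - lam * (f : Lp ℝ 2 m) x) * (v : Lp ℝ 2 m) x ∂m := by
      have e1 : inner ℝ W ψ
          = inner ℝ (f : Lp ℝ 2 m) (σ⁻¹ • ((v : Lp ℝ 2 m) - ψ) : Lp ℝ 2 m)
            - lam * inner ℝ (f : Lp ℝ 2 m) (v : Lp ℝ 2 m) := by
        rw [hW, inner_sub_left, real_inner_smul_left, real_inner_smul_left, inner_sub_left,
          E.inner_resolvent_left hσ, real_inner_smul_right, inner_sub_right]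
      have e2 := E.hasLaplacian_iff.1 (E.hasLaplacian_resolvent hσ ψ) f
      rw [e1, real_inner_comm, ← e2, E.symm, hfh v hhv, inner_eq_integral_mul,
        ← integral_const_mul, ← integral_sub hhv ((integrable_mul _ _).const_mul lam)]
      congr 1
      ext x
      ring
    rw [h1, h2]
    calc |∫ x, (h x - lam * (f : Lp ℝ 2 m) x) * (v : Lp ℝ 2 m) x ∂m|
        ≤ ∫ x, G * (v : Lp ℝ 2 m) x ∂m := by
          rw [← Real.norm_eq_abs]
          refine norm_integral_le_of_norm_le (hi.const_mul G) ?_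
          filter_upwards [hg, hv0] with x h3 h4
          rw [norm_mul, Real.norm_of_nonneg h4]
          exact mul_le_mul_of_nonneg_right h3 h4
      _ = G * ∫ x, (v : Lp ℝ 2 m) x ∂m := integral_const_mul _ _
      _ ≤ G * m.real s := mul_le_mul_of_nonneg_left hle hG
  have hWi : ∀ s, m s < ∞ → IntegrableOn W s m := fun s hms =>
    integrableOn_Lp_of_measure_ne_top _ one_le_two hms.ne
  have hc : ∀ s, m s < ∞ → IntegrableOn (fun _ => G) s m := fun s hms => integrableOn_const hms.ne
  have hup : 0 ≤ᵐ[m] fun x => G - W x := by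
    refine ae_nonneg_of_forall_setIntegral_nonneg_of_sigmaFinite
      (fun s _ hms => (hc s hms).sub (hWi s hms)) fun s hs hms => ?_
    rw [integral_sub (hc s hms) (hWi s hms), setIntegral_const, smul_eq_mul]
    linarith [le_abs_self (∫ x in s, W x ∂m), key s hs hms]
  have hlo : 0 ≤ᵐ[m] fun x => G + W x := by
    refine ae_nonneg_of_forall_setIntegral_nonneg_of_sigmaFinite
      (fun s _ hms => (hc s hms).add (hWi s hms)) fun s hs hms => ?_
    rw [integral_add (hc s hms) (hWi s hms), setIntegral_const, smul_eq_mul]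
    linarith [neg_abs_le (∫ x in s, W x ∂m), key s hs hms]
  filter_upwards [hup, hlo, coeFn_sub_smul (σ⁻¹ • ((E.resolvent σ f : Lp ℝ 2 m) - f) : Lp ℝ 2 m)
    (E.resolvent σ f : Lp ℝ 2 m) lam] with x h1 h2 h3
  rw [← h3, abs_le]
  simp only [Pi.zero_apply] at h1 h2
  exact ⟨by linarith, by linarith⟩

/-- The pointwise interpolation estimate for bounded Laplacian. -/
theorem gamma_le_four_mul_of_bounded [SigmaFinite m] (hΓ : E.IsCarreDuChamp Γ) {K lam : ℝ}
    (hBE : E.BakryEmery Γ K ∞) (hK : -K ≤ lam) (hlam : 0 ≤ lam)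
    {f : E.domain} {h : X → ℝ} (hhm : AEStronglyMeasurable h m) {C : ℝ}
    (hhb : ∀ᵐ x ∂m, |h x| ≤ C) (hfh : E.HasLaplacian f h)
    {F G : ℝ} (hF : 0 < F) (hG : 0 < G) (hf : ∀ᵐ x ∂m, |(f : Lp ℝ 2 m) x| ≤ F)
    (hg : ∀ᵐ x ∂m, |h x - lam * (f : Lp ℝ 2 m) x| ≤ G) :
    ∀ᵐ x ∂m, Γ f f x ≤ 4 * F * G := by
  refine hΓ.gamma_le_of_tendsto (tendsto_form_sub_resolvent f) tendsto_const_nhds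
    (.of_forall fun n => ?_)
  have hσ : 0 < 1 / ((n : ℝ) + 1) := by positivity
  exact gamma_le_four_mul hΓ hBE hK hlam (E.hasLaplacian_resolvent hσ f) hF hG
    (E.abs_resolvent_le hσ hF.le hf) (abs_laplacian_resolvent_le hσ hhm hhb hfh hg)

/-! ### The estimate for square integrable Laplacian -/

/-- The splitting behind the weak type estimate: `f = u + w`, where `u` solves
`(λ + a / F) u - Δ u = (a / F) f - T` with `T` the truncation of `g = Δ f - λ f` at level `a`.
The estimate for bounded Laplacians applies to `u`, and the energy of `w` is controlled by the
part `|g| - a` of `g` above the level `a`. -/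
theorem exists_splitting [SigmaFinite m] (hΓ : E.IsCarreDuChamp Γ) {K lam : ℝ}
    (hBE : E.BakryEmery Γ K ∞) (hK : -K ≤ lam) (hlam : 0 ≤ lam)
    {f : E.domain} {L : Lp ℝ 2 m} (hfL : E.HasLaplacian f L)
    {F a : ℝ} (hF : 0 < F) (ha : 0 < a) (hf : ∀ᵐ x ∂m, |(f : Lp ℝ 2 m) x| ≤ F) :
    ∃ u w : E.domain, f = u + w ∧ (∀ᵐ x ∂m, Γ u u x ≤ 32 * F * a) ∧
      ENNReal.ofReal (E.form w w) ≤ ENNReal.ofReal (3 * F) *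
        ∫⁻ x, ENNReal.ofReal (|(L - lam • (f : Lp ℝ 2 m) : Lp ℝ 2 m) x| - a) ∂m := by
  set g : Lp ℝ 2 m := L - lam • (f : Lp ℝ 2 m) with hg
  set T : Lp ℝ 2 m := (lipschitzWith_clip a).compLp (clip_zero ha.le) g with hT
  have hTx : ∀ᵐ x ∂m, T x = clip a (g x) := (lipschitzWith_clip a).coeFn_compLp (clip_zero ha.le) g
  set μ := a / F with hμ
  have hμ0 : 0 < μ := div_pos ha hF
  have hμF : μ * F = a := div_mul_cancel₀ a hF.ne'
  set κ := lam + μ with hκ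
  have hκ0 : 0 < κ := by positivity
  set k : Lp ℝ 2 m := κ⁻¹ • (μ • (f : Lp ℝ 2 m) - T) with hk
  have hkb : ∀ᵐ x ∂m, |k x| ≤ 2 * F := by
    filter_upwards [hf, hTx, coeFn_smul_sub (μ • (f : Lp ℝ 2 m)) T κ⁻¹,
      Lp.coeFn_smul μ (f : Lp ℝ 2 m)] with x h1 h2 h3 h4
    rw [hk, h3, h4, Pi.smul_apply, smul_eq_mul, h2, abs_mul, abs_of_pos (inv_pos.2 hκ0),
      inv_mul_le_iff₀ hκ0]
    have h5 := abs_clip_le ha.le (g x)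
    have h6 : |μ * (f : Lp ℝ 2 m) x| ≤ a := by
      rw [abs_mul, abs_of_pos hμ0, ← hμF]
      exact mul_le_mul_of_nonneg_left h1 hμ0.le
    calc _ ≤ a + a := (abs_sub _ _).trans (add_le_add h6 h5)
      _ ≤ κ * (2 * F) := by nlinarith [mul_nonneg hlam hF.le]
  have hσ : 0 < κ⁻¹ := inv_pos.2 hκ0
  set u := E.resolvent κ⁻¹ k with hu
  set Lu : Lp ℝ 2 m := κ⁻¹⁻¹ • ((u : Lp ℝ 2 m) - k) with hLu
  have hΔu : E.HasLaplacian u Lu := E.hasLaplacian_resolvent hσ k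
  have hub : ∀ᵐ x ∂m, |(u : Lp ℝ 2 m) x| ≤ 2 * F := E.abs_resolvent_le hσ (by positivity) hkb
  have hLu' : Lu = κ • (u : Lp ℝ 2 m) - μ • (f : Lp ℝ 2 m) + T := by
    rw [hLu, inv_inv, smul_sub, hk, smul_inv_smul₀ hκ0.ne']
    abel
  have hLub : ∀ᵐ x ∂m, |Lu x - lam * (u : Lp ℝ 2 m) x| ≤ 4 * a := by
    filter_upwards [hf, hTx, hub, Lp.coeFn_add (κ • (u : Lp ℝ 2 m) - μ • (f : Lp ℝ 2 m)) T,
      coeFn_sub_smul (κ • (u : Lp ℝ 2 m)) (f : Lp ℝ 2 m) μ, Lp.coeFn_smul κ (u : Lp ℝ 2 m)]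
      with x h1 h2 h3 h4 h5 h6
    rw [hLu', h4, Pi.add_apply, h5, h6, Pi.smul_apply, smul_eq_mul, h2]
    have h7 := abs_le.1 (abs_clip_le ha.le (g x))
    have h8 := abs_le.1 h1
    have h9 := abs_le.1 h3
    have h10 : κ * (u : Lp ℝ 2 m) x - μ * (f : Lp ℝ 2 m) x + clip a (g x)
        - lam * (u : Lp ℝ 2 m) x
        = μ * (u : Lp ℝ 2 m) x - μ * (f : Lp ℝ 2 m) x + clip a (g x) := by
      rw [hκ]
      ring
    have b1 := mul_le_mul_of_nonneg_left h8.1 hμ0.le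
    have b2 := mul_le_mul_of_nonneg_left h8.2 hμ0.le
    have b3 := mul_le_mul_of_nonneg_left h9.1 hμ0.le
    have b4 := mul_le_mul_of_nonneg_left h9.2 hμ0.le
    rw [h10, abs_le]
    exact ⟨by linarith, by linarith⟩
  set w := f - u with hw
  refine ⟨u, w, by rw [hw]; abel, ?_, ?_⟩
  · filter_upwards [gamma_le_four_mul hΓ hBE hK hlam hΔu (by positivity) (by positivity) hub hLub]
      with x hx
    linarith
  · have h1 := E.hasLaplacian_iff.1 (hfL.sub E hΔu) w
    have h2 : L - Lu = κ • (w : Lp ℝ 2 m) + (g - T) := by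
      rw [hLu', hg, hw, hκ, Submodule.coe_sub]
      module
    rw [h2, inner_add_left, real_inner_smul_left, real_inner_self_eq_norm_sq] at h1
    have h3 : E.form w w ≤ ∫ x, |(g - T : Lp ℝ 2 m) x * (w : Lp ℝ 2 m) x| ∂m := by
      have h4 : |inner ℝ (g - T) (w : Lp ℝ 2 m)|
          ≤ ∫ x, |(g - T : Lp ℝ 2 m) x * (w : Lp ℝ 2 m) x| ∂m := by
        rw [inner_eq_integral_mul]
        exact abs_integral_le_integral_abs
      have h5 := mul_nonneg hκ0.le (sq_nonneg ‖(w : Lp ℝ 2 m)‖)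
      linarith [neg_abs_le (inner ℝ (g - T) (w : Lp ℝ 2 m))]
    refine (ENNReal.ofReal_le_ofReal h3).trans ?_
    rw [ofReal_integral_eq_lintegral_ofReal (integrable_mul _ _).abs
      (.of_forall fun x => abs_nonneg _), ← lintegral_const_mul' _ _ ENNReal.ofReal_ne_top]
    refine lintegral_mono_ae ?_
    filter_upwards [hf, hub, hTx, Lp.coeFn_sub g T, Lp.coeFn_sub (f : Lp ℝ 2 m) (u : Lp ℝ 2 m)]
      with x h4 h5 h6 h7 h8
    rw [← ENNReal.ofReal_mul (by positivity), abs_mul, h7, Pi.sub_apply, h6,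
      abs_sub_clip a ha.le, mul_comm]
    have h9 : |(w : Lp ℝ 2 m) x| ≤ 3 * F := by
      rw [hw, Submodule.coe_sub, h8, Pi.sub_apply]
      exact (abs_sub _ _).trans (by linarith)
    rcases le_total (|g x| - a) 0 with h10 | h10
    · rw [max_eq_right h10, mul_zero, ENNReal.ofReal_zero]
      exact zero_le
    · rw [max_eq_left h10]
      exact ENNReal.ofReal_le_ofReal (mul_le_mul_of_nonneg_right h9 h10)

/-- The weak type estimate at the level `s`, from the splitting at `a = s / (128 F)`, for which
`Γ(f) > s` forces `Γ(w) > s / 4`. -/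
theorem ofReal_mul_meas_gamma_gt_le [SigmaFinite m] (hΓ : E.IsCarreDuChamp Γ) {K lam : ℝ}
    (hBE : E.BakryEmery Γ K ∞) (hK : -K ≤ lam) (hlam : 0 ≤ lam)
    {f : E.domain} {L : Lp ℝ 2 m} (hfL : E.HasLaplacian f L)
    {F s : ℝ} (hF : 0 < F) (hs : 0 < s) (hf : ∀ᵐ x ∂m, |(f : Lp ℝ 2 m) x| ≤ F) :
    m {x | s < Γ f f x} * ENNReal.ofReal s ≤ ENNReal.ofReal (12 * F) *
      ∫⁻ x, ENNReal.ofReal (|(L - lam • (f : Lp ℝ 2 m) : Lp ℝ 2 m) x| - s / (128 * F)) ∂m := by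
  obtain ⟨u, w, hfuw, hu, hw⟩ := exists_splitting hΓ hBE hK hlam hfL hF
    (a := s / (128 * F)) (by positivity) hf
  have hsub : m {x | s < Γ f f x}
      ≤ m {x | ENNReal.ofReal (s / 4) ≤ ENNReal.ofReal (Γ w w x)} := by
    refine measure_mono_ae ?_
    filter_upwards [hΓ.gamma_add_le_young u w one_pos, hu] with x h1 h2 (h3 : s < Γ f f x)
    rw [← hfuw] at h1
    have h4 : 32 * F * (s / (128 * F)) = s / 4 := by
      field_simp
      norm_num
    rw [h4] at h2
    refine ENNReal.ofReal_le_ofReal ?_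
    rw [inv_one] at h1
    linarith
  have hmarkov := mul_meas_ge_le_lintegral₀
    (integrable_gamma (Γ := Γ) w w).1.aemeasurable.ennreal_ofReal (ENNReal.ofReal (s / 4))
  rw [← ofReal_integral_eq_lintegral_ofReal (integrable_gamma w w) (hΓ.nonneg w),
    ← hΓ.energy] at hmarkov
  have h4 : ENNReal.ofReal s = 4 * ENNReal.ofReal (s / 4) := by
    rw [← ENNReal.ofReal_ofNat, ← ENNReal.ofReal_mul (by norm_num)]
    congr 1
    ring
  have h12 : ENNReal.ofReal (12 * F) = 4 * ENNReal.ofReal (3 * F) := by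
    rw [← ENNReal.ofReal_ofNat, ← ENNReal.ofReal_mul (by norm_num)]
    congr 1
    ring
  calc m {x | s < Γ f f x} * ENNReal.ofReal s
      ≤ m {x | ENNReal.ofReal (s / 4) ≤ ENNReal.ofReal (Γ w w x)} * ENNReal.ofReal s := by gcongr
    _ = 4 * (ENNReal.ofReal (s / 4)
          * m {x | ENNReal.ofReal (s / 4) ≤ ENNReal.ofReal (Γ w w x)}) := by
        rw [h4]
        ring
    _ ≤ 4 * (ENNReal.ofReal (3 * F) * ∫⁻ x, ENNReal.ofReal
          (|(L - lam • (f : Lp ℝ 2 m) : Lp ℝ 2 m) x| - s / (128 * F)) ∂m) := by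
        gcongr 4 * ?_
        exact hmarkov.trans hw
    _ = _ := by rw [h12, mul_assoc]

/-- The inner integral of the layer cake formula: the integrand is at most `b` and vanishes
beyond `c b`. -/
theorem lintegral_Ioi_ofReal_sub_div_le {b c : ℝ} (hb : 0 ≤ b) (hc : 0 < c) :
    ∫⁻ s in Set.Ioi 0, ENNReal.ofReal (b - s / c) ≤ ENNReal.ofReal (c * b ^ 2) := by
  calc ∫⁻ s in Set.Ioi 0, ENNReal.ofReal (b - s / c)
      ≤ ∫⁻ s in Set.Ioi 0, (Set.Ioc 0 (c * b)).indicator (fun _ => ENNReal.ofReal b) s := by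
        refine setLIntegral_mono' measurableSet_Ioi fun s (hs : 0 < s) => ?_
        by_cases h : s ≤ c * b
        · rw [Set.indicator_of_mem (show s ∈ Set.Ioc 0 (c * b) from ⟨hs, h⟩)]
          exact ENNReal.ofReal_le_ofReal (by linarith [div_pos hs hc])
        · rw [ENNReal.ofReal_of_nonpos]
          · exact zero_le
          · rw [sub_nonpos, le_div_iff₀ hc]
            linarith
    _ ≤ ∫⁻ s, (Set.Ioc 0 (c * b)).indicator (fun _ => ENNReal.ofReal b) s :=
        setLIntegral_le_lintegral _ _
    _ = ENNReal.ofReal (c * b ^ 2) := by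
        rw [lintegral_indicator_const measurableSet_Ioc, Real.volume_Ioc, sub_zero,
          ← ENNReal.ofReal_mul hb]
        congr 1
        ring

theorem eLpNorm_two_sq (φ : X → ℝ) :
    eLpNorm φ 2 m ^ (2 : ℝ) = ∫⁻ x, ENNReal.ofReal (φ x ^ (2 : ℝ)) ∂m := by
  have h := eLpNorm_nnreal_pow_eq_lintegral (f := φ) (μ := m) (p := 2) two_ne_zero
  simp only [ENNReal.coe_ofNat, NNReal.coe_ofNat] at h
  rw [h]
  refine lintegral_congr fun x => ?_
  rw [Real.rpow_two, ← sq_abs, ← Real.rpow_two, ← ENNReal.ofReal_rpow_of_nonneg (abs_nonneg _)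
    zero_le_two, ← Real.enorm_eq_ofReal_abs]

/-- The interpolation estimate in `L²`, obtained by integrating the weak type estimate over all
levels. -/
theorem eLpNorm_gamma_two_le [SigmaFinite m] (hΓ : E.IsCarreDuChamp Γ) {K lam : ℝ}
    (hBE : E.BakryEmery Γ K ∞) (hK : -K ≤ lam) (hlam : 0 ≤ lam)
    {f : E.domain} {L : Lp ℝ 2 m} (hfL : E.HasLaplacian f L)
    {F : ℝ} (hF : 0 < F) (hf : ∀ᵐ x ∂m, |(f : Lp ℝ 2 m) x| ≤ F) :
    eLpNorm (Γ f f) 2 m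
      ≤ ENNReal.ofReal (56 * F) * eLpNorm (L - lam • (f : Lp ℝ 2 m) : Lp ℝ 2 m) 2 m := by
  set g : Lp ℝ 2 m := L - lam • (f : Lp ℝ 2 m) with hg
  set c := 128 * F with hc
  have hc0 : 0 < c := by positivity
  have hgm : Measurable g := (Lp.stronglyMeasurable g).measurable
  rw [← ENNReal.rpow_le_rpow_iff (z := 2) two_pos, ENNReal.mul_rpow_of_nonneg _ _ zero_le_two,
    eLpNorm_two_sq, eLpNorm_two_sq, lintegral_rpow_eq_lintegral_meas_lt_mul m (hΓ.nonneg f)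
      (integrable_gamma f f).1.aemeasurable two_pos]
  calc ENNReal.ofReal 2 * ∫⁻ s in Set.Ioi 0, m {x | s < Γ f f x} * ENNReal.ofReal (s ^ (2 - 1 : ℝ))
      ≤ ENNReal.ofReal 2 * ∫⁻ s in Set.Ioi 0, ENNReal.ofReal (12 * F)
          * ∫⁻ x, ENNReal.ofReal (|g x| - s / c) ∂m := by
        gcongr ENNReal.ofReal 2 * ?_
        refine setLIntegral_mono' measurableSet_Ioi fun s (hs : 0 < s) => ?_
        have h1 : s ^ (2 - 1 : ℝ) = s := by norm_num
        rw [h1]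
        exact ofReal_mul_meas_gamma_gt_le hΓ hBE hK hlam hfL hF hs hf
    _ = ENNReal.ofReal 2 * (ENNReal.ofReal (12 * F)
          * ∫⁻ x, (∫⁻ s in Set.Ioi 0, ENNReal.ofReal (|g x| - s / c)) ∂m) := by
        rw [lintegral_const_mul' _ _ ENNReal.ofReal_ne_top, lintegral_lintegral_swap]
        exact Measurable.aemeasurable (by fun_prop)
    _ ≤ ENNReal.ofReal 2 * (ENNReal.ofReal (12 * F)
          * ∫⁻ x, ENNReal.ofReal (c * |g x| ^ 2) ∂m) := by
        gcongr with x
        exact lintegral_Ioi_ofReal_sub_div_le (abs_nonneg _) hc0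
    _ = ENNReal.ofReal (3072 * F ^ 2) * ∫⁻ x, ENNReal.ofReal (g x ^ (2 : ℝ)) ∂m := by
        have h1 : ∀ x, ENNReal.ofReal (c * |g x| ^ 2)
            = ENNReal.ofReal c * ENNReal.ofReal (g x ^ (2 : ℝ)) := fun x => by
          rw [sq_abs, Real.rpow_two, ENNReal.ofReal_mul hc0.le]
        simp only [h1]
        rw [lintegral_const_mul' _ _ ENNReal.ofReal_ne_top, ← mul_assoc, ← mul_assoc,
          ← ENNReal.ofReal_mul (by norm_num), ← ENNReal.ofReal_mul (by positivity), hc]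
        congr 2
        ring
    -- `3072 ≤ 56²`
    _ ≤ ENNReal.ofReal (56 * F) ^ (2 : ℝ) * ∫⁻ x, ENNReal.ofReal (g x ^ (2 : ℝ)) ∂m := by
        gcongr
        rw [ENNReal.ofReal_rpow_of_nonneg (by positivity) zero_le_two, Real.rpow_two]
        exact ENNReal.ofReal_le_ofReal (by nlinarith [sq_nonneg F])

/-! ### Norm estimates and convergence -/

theorem ae_abs_le_of_eLpNorm_top_le {φ : X → ℝ} {C : ℝ≥0∞} (hC : C ≠ ∞)
    (h : eLpNorm φ ∞ m ≤ C) : ∀ᵐ x ∂m, |φ x| ≤ C.toReal := by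
  rw [eLpNorm_exponent_top] at h
  filter_upwards [ae_le_eLpNormEssSup (f := φ) (μ := m)] with x hx
  rw [← Real.norm_eq_abs, ← toReal_enorm]
  exact ENNReal.toReal_mono hC (hx.trans h)

/-- Removal of the margin `ε` in a bound that is affine in the `L^∞` norm. -/
theorem le_ofReal_mul_of_forall_pos {A B : ℝ≥0∞} (hB : B ≠ ∞) {c F : ℝ}
    (h : ∀ ε > 0, A ≤ ENNReal.ofReal (c * (F + ε)) * B) : A ≤ ENNReal.ofReal (c * F) * B := by
  have hc : Continuous fun ε : ℝ => c * (F + ε) := by fun_prop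
  have h1 : Tendsto (fun ε : ℝ => ENNReal.ofReal (c * (F + ε)) * B) (𝓝[>] 0)
      (𝓝 (ENNReal.ofReal (c * (F + 0)) * B)) :=
    ENNReal.Tendsto.mul_const (ENNReal.tendsto_ofReal
      (tendsto_nhdsWithin_of_tendsto_nhds (hc.tendsto 0))) (Or.inr hB)
  rw [add_zero] at h1
  exact ge_of_tendsto h1 (by filter_upwards [self_mem_nhdsWithin] with ε hε using h ε hε)

theorem ae_abs_le_add {φ : X → ℝ} (hφ : MemLp φ ∞ m) {ε : ℝ} (hε : 0 < ε) :
    ∀ᵐ x ∂m, |φ x| ≤ (eLpNorm φ ∞ m).toReal + ε := by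
  filter_upwards [ae_abs_le_of_eLpNorm_top_le hφ.2.ne le_rfl] with x hx
  linarith

/-- The `L²` estimate for a Laplacian represented by a function, with the exact `L^∞` norm of
`f`, which may vanish. -/
theorem eLpNorm_gamma_two_le' [SigmaFinite m] (hΓ : E.IsCarreDuChamp Γ) {K lam : ℝ}
    (hBE : E.BakryEmery Γ K ∞) (hK : -K ≤ lam) (hlam : 0 ≤ lam) {f : E.domain} {h : X → ℝ}
    (hf : MemLp (f : Lp ℝ 2 m) ∞ m) (hh : MemLp h 2 m) (hfh : E.HasLaplacian f h) :
    eLpNorm (Γ f f) 2 m ≤ ENNReal.ofReal 56 * eLpNorm (f : Lp ℝ 2 m) ∞ m *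
      eLpNorm (fun x => h x - lam * (f : Lp ℝ 2 m) x) 2 m := by
  have hL : E.HasLaplacian f (hh.toLp h) := hfh.congr E hh.coeFn_toLp.symm
  have hg : eLpNorm (hh.toLp h - lam • (f : Lp ℝ 2 m) : Lp ℝ 2 m) 2 m
      = eLpNorm (fun x => h x - lam * (f : Lp ℝ 2 m) x) 2 m := by
    refine eLpNorm_congr_ae ?_
    filter_upwards [hh.coeFn_toLp, coeFn_sub_smul (hh.toLp h) (f : Lp ℝ 2 m) lam] with x h1 h2
    rw [h2, h1]
  rw [← hg, ← ENNReal.ofReal_toReal hf.2.ne, ← ENNReal.ofReal_mul (by norm_num)]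
  refine le_ofReal_mul_of_forall_pos (Lp.eLpNorm_ne_top _) fun ε hε => ?_
  exact eLpNorm_gamma_two_le hΓ hBE hK hlam hL (by positivity) (ae_abs_le_add hf hε)

theorem eLpNorm_gamma_top_le [SigmaFinite m] (hΓ : E.IsCarreDuChamp Γ) {K lam : ℝ}
    (hBE : E.BakryEmery Γ K ∞) (hK : -K ≤ lam) (hlam : 0 ≤ lam) {f : E.domain} {h : X → ℝ}
    (hf : MemLp (f : Lp ℝ 2 m) ∞ m) (hh : MemLp h ∞ m) (hfh : E.HasLaplacian f h) :
    eLpNorm (Γ f f) ∞ m ≤ ENNReal.ofReal 4 * eLpNorm (f : Lp ℝ 2 m) ∞ m *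
      eLpNorm (fun x => h x - lam * (f : Lp ℝ 2 m) x) ∞ m := by
  have hg : MemLp (fun x => h x - lam * (f : Lp ℝ 2 m) x) ∞ m := hh.sub (hf.const_mul lam)
  set N := eLpNorm (fun x => h x - lam * (f : Lp ℝ 2 m) x) ∞ m with hN
  have hpt : ∀ ε > 0, ∀ δ > 0, eLpNorm (Γ f f) ∞ m
      ≤ ENNReal.ofReal (4 * ((eLpNorm (f : Lp ℝ 2 m) ∞ m).toReal + ε) * (N.toReal + δ)) := by
    intro ε hε δ hδ
    rw [eLpNorm_exponent_top]
    refine eLpNormEssSup_le_of_ae_bound ?_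
    filter_upwards [gamma_le_four_mul_of_bounded hΓ hBE hK hlam hh.1
      (ae_abs_le_of_eLpNorm_top_le hh.2.ne le_rfl) hfh (by positivity) (by positivity)
      (ae_abs_le_add hf hε) (ae_abs_le_add hg hδ), hΓ.nonneg f] with x h1 h2
    rwa [Real.norm_of_nonneg h2]
  have hε : ∀ ε > 0, eLpNorm (Γ f f) ∞ m
      ≤ ENNReal.ofReal (4 * ((eLpNorm (f : Lp ℝ 2 m) ∞ m).toReal + ε)) * N := by
    intro ε hε
    have h1 := le_ofReal_mul_of_forall_pos ENNReal.one_ne_top fun δ hδ => by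
      rw [mul_one]
      exact hpt ε hε δ hδ
    rwa [mul_one, ENNReal.ofReal_mul (by positivity), ENNReal.ofReal_toReal hg.2.ne] at h1
  have h2 := le_ofReal_mul_of_forall_pos hg.2.ne hε
  rwa [ENNReal.ofReal_mul (by norm_num), ENNReal.ofReal_toReal hf.2.ne] at h2

/-- The gradient of a small perturbation is a small perturbation of the gradient. -/
theorem eLpNorm_gamma_add_sub_le (hΓ : E.IsCarreDuChamp Γ) (f v : E.domain) {δ : ℝ}
    (hδ : 0 < δ) : eLpNorm (fun x => Γ (f + v) (f + v) x - Γ f f x) 2 m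
      ≤ ENNReal.ofReal δ * eLpNorm (Γ f f) 2 m
        + ENNReal.ofReal (1 + δ⁻¹) * eLpNorm (Γ v v) 2 m := by
  have h := hΓ.gamma_add_smul f v 1
  rw [one_smul] at h
  calc eLpNorm (fun x => Γ (f + v) (f + v) x - Γ f f x) 2 m
      ≤ eLpNorm (δ • (Γ f f : X → ℝ) + (1 + δ⁻¹) • (Γ v v : X → ℝ)) 2 m := by
        refine eLpNorm_mono_ae_real ?_
        filter_upwards [h, hΓ.two_abs_gamma_le f v hδ, hΓ.nonneg v] with x h1 h2 h3
        rw [h1, Real.norm_eq_abs]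
        simp only [Pi.add_apply, Pi.smul_apply, smul_eq_mul]
        rw [abs_le]
        constructor <;> linarith [le_abs_self (Γ f v x), neg_abs_le (Γ f v x)]
    _ ≤ eLpNorm (δ • (Γ f f : X → ℝ)) 2 m + eLpNorm ((1 + δ⁻¹) • (Γ v v : X → ℝ)) 2 m :=
        eLpNorm_add_le ((integrable_gamma f f).1.const_smul _)
          ((integrable_gamma v v).1.const_smul _) one_le_two
    _ = _ := by
        rw [eLpNorm_const_smul, eLpNorm_const_smul, Real.enorm_of_nonneg hδ.le,
          Real.enorm_of_nonneg (by positivity)]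

theorem norm_le_normV (f : E.domain) : ‖(f : Lp ℝ 2 m)‖ ≤ E.normV f := by
  refine Real.le_sqrt_of_sq_le ?_
  linarith [E.nonneg f]

theorem norm_le_normD (f : E.domain) (L : Lp ℝ 2 m) : ‖(f : Lp ℝ 2 m)‖ ≤ E.normD f L :=
  (norm_le_normV f).trans (le_add_of_nonneg_right (norm_nonneg _))

theorem norm_laplacian_le_normD (f : E.domain) (L : Lp ℝ 2 m) : ‖L‖ ≤ E.normD f L := by
  have h1 : L = (f : Lp ℝ 2 m) - ((f : Lp ℝ 2 m) - L) := by abel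
  calc ‖L‖ = ‖(f : Lp ℝ 2 m) - ((f : Lp ℝ 2 m) - L)‖ := by rw [← h1]
    _ ≤ ‖(f : Lp ℝ 2 m)‖ + ‖(f : Lp ℝ 2 m) - L‖ := norm_sub_le _ _
    _ ≤ E.normD f L := add_le_add (norm_le_normV f) le_rfl

theorem eLpNorm_top_le_of_tendsto {u : ℕ → Lp ℝ 2 m} {v : Lp ℝ 2 m} {C : ℝ≥0∞}
    (hu : ∀ n, eLpNorm (u n) ∞ m ≤ C) (hlim : Tendsto u atTop (𝓝 v)) : eLpNorm v ∞ m ≤ C :=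
  eLpNorm_le_of_tendstoInMeasure (.of_forall hu) (tendstoInMeasure_of_tendsto_Lp hlim)
    fun _ => Lp.aestronglyMeasurable _

end DirichletForm

open DirichletForm

theorem mainTheorem4 :
    ∃ c : ℝ≥0∞ → ℝ, c ∞ = 2 * Real.pi ∧
      ∀ (X : Type*) [TopologicalSpace X] [PolishSpace X] [MeasurableSpace X] [BorelSpace X]
        (m : Measure X) [SigmaFinite m] [m.IsOpenPosMeasure]
        (E : DirichletForm m) (Γ : E.domain →ₗ[ℝ] E.domain →ₗ[ℝ] Lp ℝ 1 m) (K : ℝ),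
        E.StronglyLocal → E.IsCarreDuChamp Γ → E.MassPreserving → E.BakryEmery Γ K ∞ →
        -- the interpolation estimate, with `h = Δ f`
        (∀ p : ℝ≥0∞, p = 2 ∨ p = ∞ → ∀ lam : ℝ, max (-K) 0 ≤ lam →
          ∀ (f : E.domain) (h : X → ℝ), MemLp (f : Lp ℝ 2 m) ∞ m →
            MemLp h p m → E.HasLaplacian f h →
            MemLp (Γ f f) p m ∧
            eLpNorm (Γ f f) p m ≤ ENNReal.ofReal (c p) * eLpNorm (f : Lp ℝ 2 m) ∞ m *
              eLpNorm (fun x => h x - lam * (f : Lp ℝ 2 m) x) p m) ∧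
        -- the convergence statement, with `h n = Δ (f n)` and `h' = Δ f'`
        (∀ (f : ℕ → E.domain) (h : ℕ → Lp ℝ 2 m) (f' : E.domain) (h' : Lp ℝ 2 m) (C : ℝ≥0),
          (∀ n, E.HasLaplacian (f n) (h n)) → E.HasLaplacian f' h' →
          (∀ n, eLpNorm (f n : Lp ℝ 2 m) ∞ m ≤ C) →
          Tendsto (fun n => E.normD (f n - f') (h n - h')) atTop (𝓝 0) →
          MemLp (Γ f' f') 2 m ∧ (∀ n, MemLp (Γ (f n) (f n)) 2 m) ∧
          (∀ n, MemLp (Γ (f n - f') (f n - f')) 2 m) ∧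
          Tendsto (fun n => eLpNorm (fun x => (Γ (f n) (f n)) x - (Γ f' f') x) 2 m)
            atTop (𝓝 0) ∧
          Tendsto (fun n => eLpNorm (Γ (f n - f') (f n - f')) 2 m) atTop (𝓝 0)) := by
  classical
  refine ⟨fun p => if p = ∞ then 2 * Real.pi else 56, if_pos rfl, ?_⟩
  intro X _ _ _ _ m _ _ E Γ K _ hΓ _ hBE
  refine ⟨?_, ?_⟩
  · intro p hp lam hlam f h hf hh hfh
    have hK : -K ≤ lam := (le_max_left _ _).trans hlam
    have hlam0 : 0 ≤ lam := (le_max_right _ _).trans hlam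
    have hfp : MemLp (fun x => h x - lam * (f : Lp ℝ 2 m) x) p m := by
      refine hh.sub (MemLp.const_mul ?_ lam)
      rcases hp with rfl | rfl
      exacts [Lp.memLp _, hf]
    suffices hle : eLpNorm (Γ f f) p m
        ≤ ENNReal.ofReal (if p = ∞ then 2 * Real.pi else 56) * eLpNorm (f : Lp ℝ 2 m) ∞ m *
          eLpNorm (fun x => h x - lam * (f : Lp ℝ 2 m) x) p m from
      ⟨⟨(integrable_gamma f f).1, hle.trans_lt (ENNReal.mul_lt_top
        (ENNReal.mul_lt_top ENNReal.ofReal_lt_top hf.2) hfp.2)⟩, hle⟩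
    rcases hp with rfl | rfl
    · rw [if_neg ENNReal.ofNat_ne_top]
      exact eLpNorm_gamma_two_le' hΓ hBE hK hlam0 hf hh hfh
    · rw [if_pos rfl]
      refine (eLpNorm_gamma_top_le hΓ hBE hK hlam0 hf hh hfh).trans ?_
      gcongr
      linarith [Real.pi_gt_three]
  · intro f h f' h' C hfh hfh' hC hlim
    set lam := max (-K) 0 with hlam
    have hest : ∀ (u : E.domain) (L : Lp ℝ 2 m), E.HasLaplacian u L → ∀ D : ℝ≥0,
        eLpNorm (u : Lp ℝ 2 m) ∞ m ≤ D →
        eLpNorm (Γ u u) 2 m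
          ≤ ENNReal.ofReal (56 * (D + 1)) * ENNReal.ofReal ((1 + lam) * E.normD u L) := by
      intro u L hu D hD
      have hb : ∀ᵐ x ∂m, |(u : Lp ℝ 2 m) x| ≤ (D : ℝ) + 1 := by
        filter_upwards [ae_abs_le_of_eLpNorm_top_le ENNReal.coe_ne_top hD] with x hx
        rw [ENNReal.coe_toReal] at hx
        linarith
      refine (eLpNorm_gamma_two_le hΓ hBE (le_max_left _ _) (le_max_right _ _) hu
        (by positivity) hb).trans ?_
      gcongr
      rw [← Lp.enorm_def, ← ofReal_norm]
      refine ENNReal.ofReal_le_ofReal ((norm_sub_le _ _).trans ?_)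
      rw [norm_smul, Real.norm_of_nonneg (le_max_right (-K) 0)]
      have h1 := mul_le_mul_of_nonneg_left (norm_le_normD u L) (le_max_right (-K) 0)
      linarith [norm_laplacian_le_normD u L]
    have hmem : ∀ (u : E.domain) (L : Lp ℝ 2 m), E.HasLaplacian u L → ∀ D : ℝ≥0,
        eLpNorm (u : Lp ℝ 2 m) ∞ m ≤ D → MemLp (Γ u u) 2 m := fun u L hu D hD =>
      ⟨(integrable_gamma u u).1, (hest u L hu D hD).trans_lt
        (ENNReal.mul_lt_top ENNReal.ofReal_lt_top ENNReal.ofReal_lt_top)⟩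
    have hL2 : Tendsto (fun n => (f n : Lp ℝ 2 m)) atTop (𝓝 (f' : Lp ℝ 2 m)) := by
      rw [tendsto_iff_norm_sub_tendsto_zero]
      exact squeeze_zero (fun n => norm_nonneg _)
        (fun n => norm_le_normD (f n - f') (h n - h')) hlim
    have hC' : eLpNorm (f' : Lp ℝ 2 m) ∞ m ≤ C := eLpNorm_top_le_of_tendsto hC hL2
    have hsub : ∀ n, E.HasLaplacian (f n - f') (h n - h' : Lp ℝ 2 m) := fun n =>
      (hfh n).sub E hfh'
    have hCsub : ∀ n, eLpNorm ((f n - f' : E.domain) : Lp ℝ 2 m) ∞ m ≤ (C + C : ℝ≥0) := by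
      intro n
      rw [Submodule.coe_sub, eLpNorm_congr_ae (Lp.coeFn_sub _ _), ENNReal.coe_add]
      exact (eLpNorm_sub_le (Lp.aestronglyMeasurable _) (Lp.aestronglyMeasurable _) le_top).trans
        (add_le_add (hC n) hC')
    have hmem' := hmem f' h' hfh' C hC'
    have hlimsub : Tendsto (fun n => eLpNorm (Γ (f n - f') (f n - f')) 2 m) atTop (𝓝 0) := by
      have h1 : Tendsto (fun n => ENNReal.ofReal (56 * ((C + C : ℝ≥0) + 1))
          * ENNReal.ofReal ((1 + lam) * E.normD (f n - f') (h n - h'))) atTop (𝓝 0) := by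
        have h2 := ENNReal.Tendsto.const_mul (a := ENNReal.ofReal (56 * ((C + C : ℝ≥0) + 1)))
          (ENNReal.tendsto_ofReal (hlim.const_mul (1 + lam))) (Or.inr ENNReal.ofReal_ne_top)
        simpa using h2
      exact tendsto_of_tendsto_of_tendsto_of_le_of_le tendsto_const_nhds h1 (fun _ => zero_le)
        (fun n => hest _ _ (hsub n) _ (hCsub n))
    refine ⟨hmem', fun n => hmem _ _ (hfh n) C (hC n), fun n => hmem _ _ (hsub n) _ (hCsub n), ?_,
      hlimsub⟩
    rw [ENNReal.tendsto_nhds_zero]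
    intro ε hε
    obtain ⟨δ, hδε, hδ⟩ : ∃ δ : ℝ, ENNReal.ofReal δ * eLpNorm (Γ f' f') 2 m < ε ∧ 0 < δ := by
      have h1 : Tendsto (fun δ : ℝ => ENNReal.ofReal δ * eLpNorm (Γ f' f') 2 m) (𝓝[>] 0)
          (𝓝 (ENNReal.ofReal 0 * eLpNorm (Γ f' f') 2 m)) :=
        ENNReal.Tendsto.mul_const (ENNReal.tendsto_ofReal
          (tendsto_nhdsWithin_of_tendsto_nhds tendsto_id)) (Or.inr hmem'.2.ne)
      rw [ENNReal.ofReal_zero, zero_mul] at h1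
      exact ((h1.eventually_lt_const hε).and self_mem_nhdsWithin).exists
    have h2 : Tendsto (fun n => ENNReal.ofReal δ * eLpNorm (Γ f' f') 2 m
        + ENNReal.ofReal (1 + δ⁻¹) * eLpNorm (Γ (f n - f') (f n - f')) 2 m) atTop
        (𝓝 (ENNReal.ofReal δ * eLpNorm (Γ f' f') 2 m)) := by
      have h3 := tendsto_const_nhds (x := ENNReal.ofReal δ * eLpNorm (Γ f' f') 2 m) |>.add
        (ENNReal.Tendsto.const_mul (a := ENNReal.ofReal (1 + δ⁻¹)) hlimsub
          (Or.inr ENNReal.ofReal_ne_top))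
      simpa using h3
    filter_upwards [h2.eventually_lt_const hδε] with n hn
    have h4 := eLpNorm_gamma_add_sub_le hΓ f' (f n - f') hδ
    rw [add_sub_cancel] at h4
    exact h4.trans hn.le
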